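/- A $(k+1)$-path in a graph $H$ is a sequence of at least $k+1$ distinct vertices in which any two vertices at positions differing by at most $k+1$ are adjacent in $H$ (a not necessarily induced copy of the $(k+1)$-st power of a path). Its end-sets are the ordered sets of its first $k+1$ and of its last $k+1$ vertices. Let $G(n,p)$ denote the binomial random graph on the vertex set $V=\{1,\dots,n\}$. **Proposition (Absorbing Lemma).** For every integer $k\ge 0$ and every real $\varepsilon>0$ there exist $\gamma\in(0,\varepsilon/4^{k+2})$ and $C>1$ such that the following holds. Let $(G_n)_{n\in\mathbb N}$ be a sequence of graphs, $G_n$ on the vertex set $\{1,\dots,n\}$, and let $p=p(n)\in[0,1]$, such that $\delta(G_n)\ge(\tfrac{k}{k+1}+\varepsilon)n$ and $p(n)\ge C/n$ for all sufficiently large $n$. Then, with probability tending to $1$ as $n\to\infty$, the graph $H=G_n\cup G(n,p)$ has the following property. For every set of vertices $R\subseteq V$ with $|R|\le\gamma^2n$, the graph $H-R$ contains a $(k+1)$-path $A$ with at most $\gamma n/2$ vertices such that for every $U\subseteq V$ with $|U|\le 2\gamma^2n$ the graph $H[V(A)\cup U]$ contains a spanning $(k+1)$-path having the same (ordered) end-sets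 as $A$. -/

import Mathlib

namespace PowerPath

/-- The list `P = (v₀, …, v_{r-1})` is (the vertex sequence of) an `m`-path in the graph `H`, that
is, of a not necessarily induced copy of the `m`-th power of a path: the vertices are distinct, and
any two of them whose positions differ by at most `m` are adjacent in `H`. There are at least `m`
vertices, so that both end-sets exist. -/
structure IsPowerPath {V : Type*} (H : SimpleGraph V) (m : ℕ) (P : List V) : Prop where
  nodup : P.Nodup
  le_length : m ≤ P.length
  adj : ∀ (i j : ℕ) (hi : i < P.length) (hj : j < P.length), i < j → j ≤ i + m → H.Adj P[i] P[j]

/-- The first end-set of an `m`-path: its first `m` vertices, in order. -/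
def firstEnd {V : Type*} (m : ℕ) (P : List V) : List V := P.take m

/-- The last end-set of an `m`-path: its last `m` vertices, in order. -/
def lastEnd {V : Type*} (m : ℕ) (P : List V) : List V := P.drop (P.length - m)

/-- With `n = |V|`: for every set `R` of at most `γ² n` vertices there is a `(k+1)`-path `A` in
`H - R` on at most `γ n / 2` vertices such that for every set `U` of at most `2 γ² n` vertices
(which may meet `A` and `R`) there is a `(k+1)`-path in `H` with vertex set exactly `V(A) ∪ U`
and with the same ordered end-sets as `A`. -/
def HasAbsorbingPaths {V : Type*} [Fintype V] (k : ℕ) (γ : ℝ) (H : SimpleGraph V) : Prop :=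
  ∀ R : Finset V, (R.card : ℝ) ≤ γ ^ 2 * (Fintype.card V : ℝ) →
    ∃ A : List V, IsPowerPath H (k + 1) A ∧ (∀ v ∈ A, v ∉ R) ∧
      (A.length : ℝ) ≤ γ * (Fintype.card V : ℝ) / 2 ∧
      ∀ U : Finset V, (U.card : ℝ) ≤ 2 * γ ^ 2 * (Fintype.card V : ℝ) →
        ∃ B : List V, IsPowerPath H (k + 1) B ∧ (∀ v, v ∈ B ↔ v ∈ A ∨ v ∈ U) ∧
          firstEnd (k + 1) B = firstEnd (k + 1) A ∧ lastEnd (k + 1) B = lastEnd (k + 1) A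

end PowerPath

/-! Put `m = k + 1`. By the degree condition any `m` vertices have at least `ε n` common neighbours
in `G_n`. This suffices to build `k`-paths greedily; for a `(k+1)`-path the pairs at distance
exactly `k + 1` may be missing, and the random graph has to supply them. All structures are designed
so that the pairs asked of it form a matching in a pattern of bounded size. If a pattern on `s`
labels has `c n ^ s` placements, then with probability `1 - exp (-Ω(C n))`, up to polynomial
factors, some injective placement has all its matching pairs in the random graph. For large `C` this
survives a union bound over `4 ^ n * n ^ d` families of placements (`tendsto_exists_no_matching`),
so it holds for all sets to be avoided at once.

Absorbers: an absorber is a `(k+1)`-path on `2 m` vertices, and a vertex adjacent to all of them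
fits in its middle. Double counting gives, for every set `W`, an absorber that serves a fixed
proportion `c` of `W`. Repeatedly taking an absorber for the vertices served fewer than `t` times
satisfies half of `W` after `O(t / c)` choices, and iterated halving treats all vertices. With `t`
about `2 γ² n` this costs `O(γ² log (1/γ) n)` disjoint absorbers, which is far below `γ n`, and any
`t` vertices can be assigned distinct ones (`exists_family`).

Connections: two cliques are joined by induction on the power (`connectable`). Choose a hub vertex,
approach its neighbourhood from both ends, and connect inside the neighbourhood with a power one
lower; hub copies inserted at regular intervals raise the power by one again. The copies are
different vertices with the same required links, and there are many of them by averaging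
(`le_ncard_blowup`).

The path `A` strings all absorbers together by connections. Filling the middles of some absorbers
leaves both end-sets unchanged. -/

namespace PowerPath

/-- Any two entries of the list whose positions differ by at most `m` are related by `r`. -/
def PowWalk {α : Type*} (r : α → α → Prop) (m : ℕ) (l : List α) : Prop :=
  ∀ (i j : ℕ) (a b : α), i < j → j ≤ i + m → l[i]? = some a → l[j]? = some b → r a b

/-! ### Powers of walks: gluing and insertion -/

section Walks

variable {α β : Type*} {r : α → α → Prop} {m : ℕ}

theorem powWalk_nil : PowWalk r m [] := by
  intro i j a b _ _ h; simp at h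

theorem powWalk_cons {a : α} {l : List α} :
    PowWalk r m (a :: l) ↔ (∀ b ∈ l.take m, r a b) ∧ PowWalk r m l := by
  constructor
  · intro h
    refine ⟨fun b hb => ?_, fun i j c d hij hjm hc hd => ?_⟩
    · obtain ⟨i, hi⟩ := List.mem_iff_getElem?.1 hb
      rw [List.getElem?_take] at hi
      split_ifs at hi with him
      exact h 0 (i + 1) a b (by omega) (by omega) (by simp) (by simpa using hi)
    · exact h (i + 1) (j + 1) c d (by omega) (by omega) (by simpa using hc) (by simpa using hd)
  · rintro ⟨h1, h2⟩ i j c d hij hjm hc hd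
    obtain ⟨j, rfl⟩ : ∃ j', j = j' + 1 := ⟨j - 1, by omega⟩
    rcases i with _ | i
    · simp only [List.getElem?_cons_zero, Option.some.injEq] at hc
      subst hc
      refine h1 d (List.mem_iff_getElem?.2 ⟨j, ?_⟩)
      rw [List.getElem?_take, if_pos (by omega)]
      simpa using hd
    · exact h2 i j c d (by omega) (by omega) (by simpa using hc) (by simpa using hd)

/-- An entry of `P` and one of `S` are more than `m` apart, so every relevant pair is seen by one of
the two walks. -/
theorem PowWalk.glue {P Q S : List α} (h1 : PowWalk r m (P ++ Q)) (h2 : PowWalk r m (Q ++ S))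
    (hm : m ≤ Q.length) : PowWalk r m (P ++ Q ++ S) := by
  intro i j a b hij hjm ha hb
  rcases lt_or_ge j (P ++ Q).length with hj | hj
  · rw [List.getElem?_append_left (by omega)] at ha hb
    exact h1 i j a b hij hjm ha hb
  · rw [List.append_assoc] at ha hb
    have hl : (P ++ Q).length = P.length + Q.length := List.length_append
    rw [List.getElem?_append_right (by omega)] at ha hb
    exact h2 (i - P.length) (j - P.length) a b (by omega) (by omega) ha hb

theorem PowWalk.left {P Q : List α} (h : PowWalk r m (P ++ Q)) : PowWalk r m P := by
  intro i j a b hij hjm ha hb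
  have h1 : i < P.length := (List.getElem?_eq_some_iff.1 ha).1
  have h2 : j < P.length := (List.getElem?_eq_some_iff.1 hb).1
  exact h i j a b hij hjm (by rwa [List.getElem?_append_left h1])
    (by rwa [List.getElem?_append_left h2])

theorem PowWalk.right {P Q : List α} (h : PowWalk r m (P ++ Q)) : PowWalk r m Q := by
  intro i j a b hij hjm ha hb
  refine h (P.length + i) (P.length + j) a b (by omega) (by omega) ?_ ?_ <;>
  · rw [List.getElem?_append_right (by omega)]
    simpa

theorem PowWalk.reverse (hr : ∀ a b, r a b → r b a) {l : List α} (h : PowWalk r m l) :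
    PowWalk r m l.reverse := by
  intro i j a b hij hjm ha hb
  have h1 : i < l.length := by simpa using (List.getElem?_eq_some_iff.1 ha).1
  have h2 : j < l.length := by simpa using (List.getElem?_eq_some_iff.1 hb).1
  rw [List.getElem?_reverse h1] at ha
  rw [List.getElem?_reverse h2] at hb
  exact hr _ _ (h _ _ b a (by omega) (by omega) hb ha)

theorem PowWalk.of_forall₂ {r' : β → β → Prop} {R : α → β → Prop} {l : List α} {l' : List β}
    (hl : List.Forall₂ R l l')
    (hr : ∀ a b a' b', R a a' → R b b' → r a b → r' a' b') (h : PowWalk r m l) :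
    PowWalk r' m l' := by
  intro i j a' b' hij hjm ha hb
  obtain ⟨hi, rfl⟩ := List.getElem?_eq_some_iff.1 ha
  obtain ⟨hj, rfl⟩ := List.getElem?_eq_some_iff.1 hb
  have hlen := hl.length_eq
  refine hr _ _ _ _ (hl.get (by omega) hi) (hl.get (by omega) hj)
    (h i j _ _ hij hjm (List.getElem?_eq_getElem (by omega)) (List.getElem?_eq_getElem (by omega)))

/-- Insert one entry of `vs` after each `m` entries of `t`. -/
def insertEvery (m : ℕ) : List α → List α → List α
  | [], t => t
  | v :: vs, t => t.take m ++ v :: insertEvery m vs (t.drop m)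

theorem insertEvery_perm (m : ℕ) (vs t : List α) : (insertEvery m vs t).Perm (vs ++ t) := by
  induction vs generalizing t with
  | nil => simp [insertEvery]
  | cons v vs ih =>
    rw [insertEvery]
    refine List.perm_middle.trans ?_
    rw [List.cons_append]
    refine List.Perm.cons v ?_
    refine ((ih _).append_left _).trans ?_
    rw [← List.append_assoc]
    refine (List.perm_append_comm.append_right _).trans ?_
    rw [List.append_assoc, List.take_append_drop]

theorem insertEvery_map (g : α → β) (m : ℕ) (vs t : List α) :
    (insertEvery m vs t).map g = insertEvery m (vs.map g) (t.map g) := by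
  induction vs generalizing t with
  | nil => simp [insertEvery]
  | cons v vs ih => simp [insertEvery, ih]

theorem insertEvery_append {m : ℕ} {vs t : List α} (h : m * vs.length = t.length) (u : List α) :
    insertEvery m vs (t ++ u) = insertEvery m vs t ++ u := by
  induction vs generalizing t with
  | nil =>
    simp [insertEvery]
  | cons v vs ih =>
    rw [List.length_cons, Nat.mul_succ] at h
    rw [insertEvery, insertEvery, List.take_append_of_le_length (by omega),
      List.drop_append_of_le_length (by omega), ih (by simp; omega)]
    simp

/-- The blocks use up `t` exactly, so the sequence closes with an inserted entry. The right approach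
will attach to the hub copy found there. -/
theorem cons_insertEvery_eq_concat {m : ℕ} {v w : α} {vs t : List α}
    (h : m * vs.length = t.length) (hw : (v :: vs).getLast? = some w) :
    ∃ s, v :: insertEvery m vs t = s ++ [w] := by
  induction vs generalizing t v with
  | nil =>
    have : t = [] := by simpa using h.symm
    exact ⟨[], by simpa [insertEvery, this] using hw⟩
  | cons v' vs ih =>
    rw [List.length_cons, Nat.mul_succ] at h
    obtain ⟨s, hs⟩ := ih (v := v') (t := t.drop m) (by simp; omega) (by simpa using hw)
    refine ⟨v :: t.take m ++ s, ?_⟩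
    rw [insertEvery, hs]
    simp

theorem insertEvery_take {m : ℕ} {vs t : List α} (h : m * vs.length ≤ t.length) :
    (insertEvery m vs t).take m = t.take m := by
  cases vs with
  | nil => simp [insertEvery]
  | cons v vs =>
    rw [List.length_cons, Nat.mul_succ] at h
    have : (t.take m).length = m := by simp; omega
    rw [insertEvery, List.take_append_of_le_length (by omega), List.take_take, min_self]

/-- Across `v` all distances grow by one, so distance `m + 1` afterwards was distance `m` before.
Within `A` no gain is needed, since its at most `m + 1` entries are at distance at most `m` anyway.
From `A` only the first `m` entries of `R` are in reach, so `R` may contain further insertions. -/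
theorem PowWalk.insert_block {A T R : List α} {v : α} (hA : A.length ≤ m + 1)
    (hR : R.take m = T.take m) (hAT : PowWalk r m (A ++ T)) (hv : PowWalk r (m + 1) (v :: R))
    (hrv : ∀ a ∈ A, r a v) : PowWalk r (m + 1) (A ++ v :: R) := by
  induction A with
  | nil => simpa using hv
  | cons a A ih =>
    rw [List.cons_append, powWalk_cons] at hAT ⊢
    rw [List.length_cons] at hA
    refine ⟨fun b hb => ?_, ih (by omega) hAT.2 fun a ha => hrv a (List.mem_cons_of_mem _ ha)⟩
    rw [List.take_append, List.take_of_length_le (by omega), List.mem_append] at hb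
    have hsub : m + 1 - A.length = (m - A.length) + 1 := by omega
    rw [hsub, List.take_succ_cons, List.mem_cons] at hb
    rcases hb with hb | rfl | hb
    · refine hAT.1 b ?_
      rw [List.take_append, List.take_of_length_le (by omega)]
      exact List.mem_append_left _ hb
    · exact hrv a (by simp)
    · refine hAT.1 b ?_
      rw [List.take_append]
      refine List.mem_append_right _ ?_
      have := congrArg (List.take (m - A.length)) hR
      rw [List.take_take, List.take_take, min_eq_left (by omega)] at this
      rwa [← this]

/-- Blocks have `m + 1` entries, so a pair at distance `m + 1` contains an inserted entry or
straddles one. Inserted entries are `m + 2` apart and need not be related to each other. The upper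
bound on `t.length` keeps the piece after the last insertion to one block. -/
theorem PowWalk.insertEvery {vs t : List α} (hlo : (m + 1) * vs.length ≤ t.length)
    (hhi : t.length ≤ (m + 1) * (vs.length + 1)) (ht : PowWalk r m t)
    (hv : ∀ v ∈ vs, ∀ a ∈ t, r v a ∧ r a v) :
    PowWalk r (m + 1) (insertEvery (m + 1) vs t) := by
  induction vs generalizing t with
  | nil =>
    simp only [List.length_nil, zero_add, mul_one] at hhi
    intro i j a b hij hjm ha hb
    have h2 : j < t.length := (List.getElem?_eq_some_iff.1 hb).1
    exact ht i j a b hij (by omega) ha hb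
  | cons v vs ih =>
    rw [List.length_cons, Nat.mul_succ] at hlo hhi
    rw [PowerPath.insertEvery]
    have hT : (m + 1) * vs.length ≤ (t.drop (m + 1)).length := by simp; omega
    refine PowWalk.insert_block (T := t.drop (m + 1)) (by simp) ?_ ?_ ?_ ?_
    · have := congrArg (List.take m) (insertEvery_take hT)
      simpa [List.take_take] using this
    · rwa [List.take_append_drop]
    · rw [powWalk_cons, insertEvery_take hT]
      refine ⟨fun b hb => (hv v (by simp) b ?_).1, ih hT ?_ ?_ ?_⟩
      · exact List.mem_of_mem_drop (List.mem_of_mem_take hb)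
      · rw [List.length_drop, Nat.mul_succ]
        rw [Nat.mul_succ] at hhi
        omega
      · rw [← List.take_append_drop (m + 1) t] at ht
        exact ht.right
      · exact fun w hw a ha => hv w (List.mem_cons_of_mem _ hw) a (List.mem_of_mem_drop ha)
    · exact fun a ha => (hv v (by simp) a (List.mem_of_mem_take ha)).2

end Walks

/-! ### Averaging over fibres -/

section Counting

variable {A B : Type*} [Fintype A] [Fintype B]

theorem ncard_eq_sum_fiber (S : Set (A × B)) :
    S.ncard = ∑ a, {b | (a, b) ∈ S}.ncard := by
  have e : S ≃ Σ a, {b | (a, b) ∈ S} :=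
    { toFun := fun x => ⟨x.1.1, x.1.2, x.2⟩
      invFun := fun y => ⟨(y.1, y.2.1), y.2.2⟩
      left_inv := fun _ => rfl
      right_inv := fun _ => rfl }
  rw [← Nat.card_coe_set_eq, Nat.card_congr e, Nat.card_sigma]
  simp [Nat.card_coe_set_eq]

theorem mul_le_ncard_of_fiber {S : Set (A × B)} {T : Set A} {c₁ c₂ : ℝ} (h₂ : 0 ≤ c₂)
    (hT : c₁ ≤ T.ncard) (hS : ∀ a ∈ T, c₂ ≤ {b | (a, b) ∈ S}.ncard) : c₁ * c₂ ≤ S.ncard := by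
  classical
  rw [ncard_eq_sum_fiber, Nat.cast_sum]
  calc c₁ * c₂ ≤ T.ncard * c₂ := by gcongr
    _ = ∑ a ∈ T.toFinset, c₂ := by
      rw [Finset.sum_const, nsmul_eq_mul, Set.ncard_eq_toFinset_card']
    _ ≤ ∑ a ∈ T.toFinset, ({b | (a, b) ∈ S}.ncard : ℝ) :=
      Finset.sum_le_sum fun a ha => hS a (by simpa using ha)
    _ ≤ ∑ a, ({b | (a, b) ∈ S}.ncard : ℝ) :=
      Finset.sum_le_sum_of_subset_of_nonneg (Finset.subset_univ _) fun _ _ _ => by positivity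

theorem ncard_le_fintype_card (S : Set A) : S.ncard ≤ Fintype.card A := by
  rw [← Nat.card_eq_fintype_card, ← Set.ncard_univ]
  exact Set.ncard_le_ncard (Set.subset_univ _)

/-- The poor fibres together account for at most half of the guaranteed size of `S`, and a rich
fibre has at most `Fintype.card B` elements. -/
theorem le_ncard_rich_fiber [Nonempty B] {S : Set (A × B)} {c : ℝ} (hc : 0 ≤ c)
    (hS : c * Fintype.card A * Fintype.card B ≤ S.ncard) :
    c / 2 * Fintype.card A ≤ {a | c / 2 * Fintype.card B ≤ ({b | (a, b) ∈ S}.ncard : ℝ)}.ncard := by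
  classical
  set T := {a | c / 2 * Fintype.card B ≤ ({b | (a, b) ∈ S}.ncard : ℝ)} with hT
  have hB : (0 : ℝ) < Fintype.card B := by exact_mod_cast Fintype.card_pos
  rw [ncard_eq_sum_fiber, Nat.cast_sum] at hS
  have h1 : ∀ a, ({b | (a, b) ∈ S}.ncard : ℝ) ≤
      (if a ∈ T then (Fintype.card B : ℝ) else 0) + c / 2 * Fintype.card B := by
    intro a
    split_ifs with ha
    · have : ({b | (a, b) ∈ S}.ncard : ℝ) ≤ Fintype.card B := by
        exact_mod_cast ncard_le_fintype_card _
      nlinarith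
    · rw [hT, Set.mem_ofPred_eq, not_le] at ha
      linarith
  have h2 := Finset.sum_le_sum fun a (_ : a ∈ Finset.univ) => h1 a
  rw [Finset.sum_add_distrib, Finset.sum_const, ← Finset.sum_filter, Finset.sum_const,
    nsmul_eq_mul, nsmul_eq_mul, Finset.card_univ] at h2
  have h3 : ((Finset.univ.filter (· ∈ T)).card : ℝ) = T.ncard := by
    rw [Set.ncard_eq_toFinset_card']
    congr 2
    ext; simp
  rw [h3] at h2
  have h4 : (c / 2 * Fintype.card A) * Fintype.card B ≤ T.ncard * Fintype.card B := by
    linarith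
  exact le_of_mul_le_mul_right h4 hB

theorem ncard_pi_const {A : Type*} (r : ℕ) (D : Set A) : {v : Fin r → A | ∀ i, v i ∈ D}.ncard = D.ncard ^ r := by
  have e : {v : Fin r → A | ∀ i, v i ∈ D} ≃ (Fin r → D) :=
    { toFun := fun v i => ⟨v.1 i, v.2 i⟩
      invFun := fun w => ⟨fun i => w i, fun i => (w i).2⟩
      left_inv := fun _ => rfl
      right_inv := fun _ => rfl }
  rw [← Nat.card_coe_set_eq, Nat.card_congr e, Nat.card_fun, Nat.card_coe_set_eq]
  simp

theorem ncard_preimage_swap {A B : Type*} (T : Set (A × B)) :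
    (Prod.swap ⁻¹' T : Set (B × A)).ncard = T.ncard :=
  Set.ncard_preimage_of_injective_subset_range Prod.swap_injective
    (by rw [Prod.swap_surjective.range_eq]; exact Set.subset_univ _)

/-- Many points of `B` have a rich fibre in `A`, and each contributes all `r`-tuples from its fibre.
This provides `r` interchangeable copies of a vertex. -/
theorem le_ncard_blowup [Nonempty A] [Nonempty B] {S : Set (A × B)} {c : ℝ} (hc : 0 ≤ c) (r : ℕ)
    (hS : c * Fintype.card A * Fintype.card B ≤ S.ncard) :
    (c / 2) ^ (r + 1) * (Fintype.card A : ℝ) ^ r * Fintype.card B ≤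
      {x : (Fin r → A) × B | ∀ i, (x.1 i, x.2) ∈ S}.ncard := by
  have h1 := le_ncard_rich_fiber (S := (Prod.swap ⁻¹' S : Set (B × A))) hc
    (by rw [ncard_preimage_swap]; linarith)
  have h2 := mul_le_ncard_of_fiber (c₂ := (c / 2 * Fintype.card A) ^ r)
    (S := {x : B × (Fin r → A) | ∀ i, (x.2 i, x.1) ∈ S}) (by positivity) h1 (by
      intro b hb
      have := ncard_pi_const r {a | (a, b) ∈ S}
      change _ ≤ (({v : Fin r → A | ∀ i, v i ∈ {a | (a, b) ∈ S}}.ncard : ℕ) : ℝ)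
      rw [this, Nat.cast_pow]
      exact pow_le_pow_left₀ (by positivity) hb r)
  have h3 : {x : B × (Fin r → A) | ∀ i, (x.2 i, x.1) ∈ S}.ncard =
      {x : (Fin r → A) × B | ∀ i, (x.1 i, x.2) ∈ S}.ncard :=
    ncard_preimage_swap {x : (Fin r → A) × B | ∀ i, (x.1 i, x.2) ∈ S}
  rw [h3] at h2
  refine le_trans (le_of_eq ?_) h2
  rw [pow_succ, mul_pow]
  ring

end Counting

/-! ### Counting placements of a pattern -/

section Functions

variable {V : Type*} [Fintype V]

theorem ncard_sum_arrow {V ι κ : Type*} (S : Set ((ι → V) × (κ → V))) :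
    {f : ι ⊕ κ → V | (f ∘ Sum.inl, f ∘ Sum.inr) ∈ S}.ncard = S.ncard := by
  have := Set.ncard_preimage_of_injective_subset_range (s := S)
    (f := Equiv.sumArrowEquivProdArrow ι κ V) (Equiv.injective _)
    (by rw [(Equiv.surjective _).range_eq]; exact Set.subset_univ _)
  rw [← this]
  rfl

theorem le_ncard_greedy {β : ℝ} (hβ : 0 ≤ β) (Q : List V → Prop) (N : ℕ) (h0 : Q [])
    (hs : ∀ l, l.length < N → Q l → β ≤ {a | Q (l ++ [a])}.ncard) :
    β ^ N ≤ {g : Fin N → V | Q (List.ofFn g)}.ncard := by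
  induction N with
  | zero =>
    have : {g : Fin 0 → V | Q (List.ofFn g)} = Set.univ := by
      ext g; simp [h0]
    rw [this, Set.ncard_univ]
    simp
  | succ N ih =>
    have ih := ih fun l hl => hs l (by omega)
    have h := mul_le_ncard_of_fiber
      (S := {x : (Fin N → V) × V | Q (List.ofFn x.1 ++ [x.2])}) hβ ih
      (fun g (hg : Q (List.ofFn g)) => hs (List.ofFn g) (by rw [List.length_ofFn]; omega) hg)
    rw [pow_succ]
    refine h.trans ?_
    rw [Nat.cast_le]
    refine Set.ncard_le_ncard_of_injOn
      (fun x : (Fin N → V) × V => (Fin.snoc x.1 x.2 : Fin (N + 1) → V)) ?_ ?_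
    · intro x hx
      simp only [Set.mem_ofPred_eq] at hx ⊢
      rw [List.ofFn_succ']
      simpa using hx
    · intro x _ y _ hxy
      have h1 := congrArg (Fin.init (α := fun _ => V)) hxy
      have h2 := congrFun hxy (Fin.last N)
      simp only [Fin.init_snoc, Fin.snoc_last] at h1 h2
      exact Prod.ext h1 h2

variable {ι : Type*} [Fintype ι] [DecidableEq ι]

theorem ncard_not_injective_mul_le :
    {f : ι → V | ¬ Function.Injective f}.ncard * Fintype.card V ≤
      Fintype.card ι ^ 2 * Fintype.card V ^ Fintype.card ι := by
  classical
  have h1 : ∀ e : ι × ι, e.1 ≠ e.2 →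
      {f : ι → V | f e.1 = f e.2}.ncard * Fintype.card V ≤ Fintype.card V ^ Fintype.card ι := by
    intro e he
    have : (({f : ι → V | f e.1 = f e.2} ×ˢ (Set.univ : Set V)).ncard) ≤
        (Set.univ : Set (ι → V)).ncard := by
      -- Overwriting the second of two equal values loses nothing, as the first still records it.
      refine Set.ncard_le_ncard_of_injOn (fun x => Function.update x.1 e.2 x.2) (by simp) ?_
      rintro ⟨f, a⟩ ⟨hf, -⟩ ⟨g, b⟩ ⟨hg, -⟩ h
      simp only [Set.mem_ofPred_eq] at hf hg h
      have hab : a = b := by simpa using congrFun h e.2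
      have h2 : ∀ i, i ≠ e.2 → f i = g i := fun i hi => by
        simpa [Function.update_of_ne hi] using congrFun h i
      refine Prod.ext (funext fun i => ?_) hab
      by_cases hi : i = e.2
      · subst hi
        change f e.2 = g e.2
        rw [← hf, ← hg, h2 _ he]
      · exact h2 i hi
    rw [Set.ncard_prod, Set.ncard_univ, Set.ncard_univ] at this
    simpa [Nat.card_eq_fintype_card] using this
  have h2 : {f : ι → V | ¬ Function.Injective f} ⊆
      ⋃ e ∈ (Finset.univ.filter fun e : ι × ι => e.1 ≠ e.2), {f : ι → V | f e.1 = f e.2} := by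
    intro f hf
    simp only [Function.Injective, Set.mem_ofPred_eq, not_forall] at hf
    obtain ⟨a, b, hab, hne⟩ := hf
    simp only [Set.mem_iUnion]
    exact ⟨(a, b), by simpa using hne, hab⟩
  calc _ ≤ (∑ e ∈ (Finset.univ.filter fun e : ι × ι => e.1 ≠ e.2),
      {f : ι → V | f e.1 = f e.2}.ncard) * Fintype.card V := by
        gcongr
        exact (Set.ncard_le_ncard h2).trans (Finset.set_ncard_biUnion_le _ _)
    _ ≤ ∑ e ∈ (Finset.univ.filter fun e : ι × ι => e.1 ≠ e.2), Fintype.card V ^ Fintype.card ι := by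
        rw [Finset.sum_mul]
        exact Finset.sum_le_sum fun e he => h1 e (by simpa using he)
    _ ≤ _ := by
        rw [Finset.sum_const, smul_eq_mul]
        gcongr
        refine (Finset.card_filter_le _ _).trans ?_
        simp [sq]

theorem le_ncard_injective {F : Set (ι → V)} {c : ℝ} (hc : 0 < c)
    (hV : 2 * (Fintype.card ι : ℝ) ^ 2 / c ≤ Fintype.card V) (hV0 : 0 < Fintype.card V)
    (hF : c * (Fintype.card V : ℝ) ^ Fintype.card ι ≤ F.ncard) :
    c / 2 * (Fintype.card V : ℝ) ^ Fintype.card ι ≤ {f ∈ F | Function.Injective f}.ncard := by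
  have h1 := ncard_not_injective_mul_le (V := V) (ι := ι)
  have h2 : F.ncard ≤ {f ∈ F | Function.Injective f}.ncard +
      {f : ι → V | ¬ Function.Injective f}.ncard := by
    refine (Set.ncard_le_ncard ?_).trans (Set.ncard_union_le _ _)
    intro f hf
    by_cases h : Function.Injective f
    · exact Or.inl ⟨hf, h⟩
    · exact Or.inr h
  have h1' : ({f : ι → V | ¬ Function.Injective f}.ncard : ℝ) * Fintype.card V ≤
      (Fintype.card ι : ℝ) ^ 2 * (Fintype.card V : ℝ) ^ Fintype.card ι := by exact_mod_cast h1
  have h2' : (F.ncard : ℝ) ≤ {f ∈ F | Function.Injective f}.ncard +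
      {f : ι → V | ¬ Function.Injective f}.ncard := by exact_mod_cast h2
  have hn : (0 : ℝ) < Fintype.card V := by exact_mod_cast hV0
  rw [div_le_iff₀ hc] at hV
  set N : ℝ := (Fintype.card V : ℝ) ^ Fintype.card ι
  have hN : 0 < N := by positivity
  have h3 : ({f : ι → V | ¬ Function.Injective f}.ncard : ℝ) ≤ c / 2 * N := by
    refine le_of_mul_le_mul_right (h1'.trans ?_) hn
    nlinarith
  linarith

/-- Separates the values at `i` and `j` from the others without changing the label type; the
overwritten values of the second component are free, whence the factor `Fintype.card V ^ 2`. -/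
theorem ncard_update_pair {F : Set (ι → V)} {i j : ι} (hij : i ≠ j) :
    Fintype.card V ^ 2 * F.ncard ≤
      {x : (V × V) × (ι → V) |
        Function.update (Function.update x.2 i x.1.1) j x.1.2 ∈ F}.ncard := by
  have : ((Set.univ : Set (V × V)) ×ˢ F).ncard ≤ {x : (V × V) × (ι → V) |
        Function.update (Function.update x.2 i x.1.1) j x.1.2 ∈ F}.ncard := by
    refine Set.ncard_le_ncard_of_injOn (fun x => ((x.2 i, x.2 j),
      Function.update (Function.update x.2 i x.1.1) j x.1.2)) ?_ ?_
    · rintro ⟨⟨a, b⟩, f⟩ ⟨-, hf⟩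
      simp only [Set.mem_ofPred_eq] at hf ⊢
      convert hf using 1
      ext s
      by_cases h1 : s = j
      · subst h1; simp
      · by_cases h2 : s = i
        · subst h2; simp [Function.update_of_ne h1]
        · simp [Function.update_of_ne h1, Function.update_of_ne h2]
    · rintro ⟨⟨a, b⟩, f⟩ - ⟨⟨a', b'⟩, f'⟩ - h
      simp only [Prod.mk.injEq] at h ⊢
      obtain ⟨⟨h1, h2⟩, h3⟩ := h
      have hi := congrFun h3 i
      have hj := congrFun h3 j
      simp [Function.update_of_ne hij] at hi hj
      refine ⟨⟨hi, hj⟩, funext fun s => ?_⟩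
      by_cases hs1 : s = j
      · rw [hs1, h2]
      · by_cases hs2 : s = i
        · rw [hs2, h1]
        · simpa [Function.update_of_ne hs1, Function.update_of_ne hs2] using congrFun h3 s
  rw [Set.ncard_prod, Set.ncard_univ] at this
  simpa [Nat.card_eq_fintype_card, sq] using this

end Functions

/-! ### Matchings of labels -/

section Matching

variable {ι κ : Type*}

/-- The pairs in the list are disjoint two-element sets. -/
def IsMatchingList (M : List (ι × ι)) : Prop :=
  (∀ e ∈ M, e.1 ≠ e.2) ∧
    M.Pairwise fun e e' => e.1 ≠ e'.1 ∧ e.1 ≠ e'.2 ∧ e.2 ≠ e'.1 ∧ e.2 ≠ e'.2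

theorem IsMatchingList.append {M₁ M₂ : List (ι × ι)} (h₁ : IsMatchingList M₁)
    (h₂ : IsMatchingList M₂) (S : ι → Prop) (hS₁ : ∀ e ∈ M₁, S e.1 ∧ S e.2)
    (hS₂ : ∀ e ∈ M₂, ¬ S e.1 ∧ ¬ S e.2) : IsMatchingList (M₁ ++ M₂) := by
  refine ⟨fun e he => ?_, List.pairwise_append.2 ⟨h₁.2, h₂.2, fun e he e' he' => ?_⟩⟩
  · rcases List.mem_append.1 he with he | he
    exacts [h₁.1 e he, h₂.1 e he]
  · have h1 := hS₁ e he
    have h2 := hS₂ e' he'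
    refine ⟨?_, ?_, ?_, ?_⟩ <;> intro h
    · exact h2.1 (h ▸ h1.1)
    · exact h2.2 (h ▸ h1.1)
    · exact h2.1 (h ▸ h1.2)
    · exact h2.2 (h ▸ h1.2)

theorem IsMatchingList.map {M : List (ι × ι)} (h : IsMatchingList M) {g : ι → κ}
    (hg : Function.Injective g) : IsMatchingList (M.map (Prod.map g g)) := by
  refine ⟨fun e he => ?_, ?_⟩
  · obtain ⟨e', he', rfl⟩ := List.mem_map.1 he
    exact fun h' => h.1 e' he' (hg h')
  · rw [List.pairwise_map]
    exact h.2.imp fun ⟨h1, h2, h3, h4⟩ =>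
      ⟨fun h => h1 (hg h), fun h => h2 (hg h), fun h => h3 (hg h), fun h => h4 (hg h)⟩

/-- The pairs consisting of an entry of `L` or `w` and of the entry `j + 1` places before it, for
the last `j + 1` entries of the sequence `L` followed by `w`. -/
def leadMatching (j e : ℕ) (L : Fin (j + 1 + e + j) → ι) (w : ι) : List (ι × ι) :=
  List.ofFn (fun i : Fin j =>
    (L ⟨e + i, by omega⟩, L ⟨j + 1 + e + i, by omega⟩)) ++ [(L ⟨e + j, by omega⟩, w)]

/-- The first members have indices `e` to `e + j`; the second members have indices at least `j + 1 +
e` or equal `w`. So no label occurs twice. -/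
theorem isMatchingList_leadMatching {j e : ℕ} {L : Fin (j + 1 + e + j) → ι} {w : ι}
    (hL : Function.Injective L) (hw : ∀ a, L a ≠ w) : IsMatchingList (leadMatching j e L w) := by
  constructor
  · intro p hp
    rcases List.mem_append.1 hp with hp | hp
    · obtain ⟨i, rfl⟩ := (List.mem_ofFn' _ _).1 hp
      simp only [ne_eq, hL.eq_iff, Fin.mk.injEq]
      omega
    · rw [List.mem_singleton] at hp
      subst hp
      exact hw _
  · refine List.pairwise_append.2 ⟨?_, by simp, ?_⟩
    · rw [List.pairwise_ofFn]
      intro a b hab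
      have := Fin.lt_def.1 hab
      simp only [ne_eq, hL.eq_iff, Fin.mk.injEq]
      omega
    · intro p hp p' hp'
      obtain ⟨i, rfl⟩ := (List.mem_ofFn' _ _).1 hp
      rw [List.mem_singleton] at hp'
      subst hp'
      simp only [ne_eq, hL.eq_iff, Fin.mk.injEq]
      refine ⟨by omega, hw _, by omega, hw _⟩

theorem leadMatching_support {j e : ℕ} {L : Fin (j + 1 + e + j) → ι} {w : ι} {S : ι → Prop}
    (hL : ∀ a, S (L a)) (hw : S w) : ∀ p ∈ leadMatching j e L w, S p.1 ∧ S p.2 := by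
  intro p hp
  rcases List.mem_append.1 hp with hp | hp
  · obtain ⟨i, rfl⟩ := (List.mem_ofFn' _ _).1 hp
    exact ⟨hL _, hL _⟩
  · rw [List.mem_singleton] at hp
    subst hp
    exact ⟨hL _, hw⟩

end Matching

/-! ### Approaching the neighbourhood of a hub vertex -/

section Connecting

variable {V ι κ : Type*}

/-- Adjacency of two labelled vertices, where the pairs of labels in `M` are exempt. -/
def LinkRel (G : SimpleGraph V) (M : List (ι × ι)) (p q : V × Option ι) : Prop :=
  G.Adj p.1 q.1 ∨
    ∃ e ∈ M, (p.2 = some e.1 ∧ q.2 = some e.2) ∨ (p.2 = some e.2 ∧ q.2 = some e.1)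

theorem LinkRel.symm {G : SimpleGraph V} {M : List (ι × ι)} {p q : V × Option ι}
    (h : LinkRel G M p q) : LinkRel G M q p := by
  rcases h with h | ⟨e, he, h | h⟩
  · exact Or.inl h.symm
  · exact Or.inr ⟨e, he, Or.inr ⟨h.2, h.1⟩⟩
  · exact Or.inr ⟨e, he, Or.inl ⟨h.2, h.1⟩⟩

/-- A list of unlabelled vertices. -/
def plain (x : List V) : List (V × Option ι) := x.map fun a => (a, none)

/-- The list of vertices that `f` assigns to the labels in a list. -/
def labelled (f : ι → V) (π : List ι) : List (V × Option ι) := π.map fun i => (f i, some i)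

/-- Any at most `m` vertices of `Y` have at least `β` common neighbours in `X`. -/
def HasCommonNbrs (G : SimpleGraph V) (X Y : Set V) (m : ℕ) (β : ℝ) : Prop :=
  ∀ l : List V, l.length ≤ m → (∀ a ∈ l, a ∈ Y) →
    β ≤ ({w | w ∈ X ∧ ∀ a ∈ l, G.Adj a w}.ncard : ℝ)

/-- `l` can be appended to `x` so that each of its first `A` entries is adjacent to the preceding
`j + 1` vertices, and each later one to the preceding `j` vertices and to `v`. -/
def IsLead (G : SimpleGraph V) (X : Set V) (j A : ℕ) (x : List V) (v : V) (l : List V) : Prop :=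
  (∀ a ∈ l, a ∈ X) ∧ (∀ (p : ℕ) (a : V), l[p]? = some a → A ≤ p → G.Adj v a) ∧
    ∀ (s t : ℕ) (a b : V), s < t → t ≤ s + j + 1 → (t ≤ s + j ∨ t < j + 1 + A) →
      (x ++ l)[s]? = some a → (x ++ l)[t]? = some b → G.Adj a b

theorem isLead_nil {G : SimpleGraph V} {X : Set V} {j A : ℕ} {x : List V} {v : V}
    (hx : x.Pairwise G.Adj) : IsLead G X j A x v [] := by
  refine ⟨by simp, by simp, fun s t a b hst _ _ hs ht => ?_⟩
  rw [List.append_nil] at hs ht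
  obtain ⟨h1, rfl⟩ := List.getElem?_eq_some_iff.1 hs
  obtain ⟨h2, rfl⟩ := List.getElem?_eq_some_iff.1 ht
  exact List.pairwise_iff_getElem.1 hx _ _ h1 h2 hst

theorem IsLead.concat {G : SimpleGraph V} {X : Set V} {j A : ℕ} {x l : List V} {v a : V}
    (hx : x.length = j + 1) (h : IsLead G X j A x v l) (ha : a ∈ X)
    (hK : ∀ u ∈ (if l.length < A then (x ++ l).drop l.length
      else v :: (x ++ l).drop (l.length + 1)), G.Adj u a) :
    IsLead G X j A x v (l ++ [a]) := by
  obtain ⟨h1, h2, h3⟩ := h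
  refine ⟨?_, ?_, ?_⟩
  · intro b hb
    rcases List.mem_append.1 hb with hb | hb
    · exact h1 b hb
    · rw [List.mem_singleton] at hb
      exact hb ▸ ha
  · intro p b hp hA
    rcases lt_or_ge p l.length with hpl | hpl
    · rw [List.getElem?_append_left hpl] at hp
      exact h2 p b hp hA
    · rw [List.getElem?_append_right hpl] at hp
      obtain ⟨h4, rfl⟩ := List.getElem?_eq_some_iff.1 hp
      simp only [List.length_singleton] at h4
      rw [if_neg (by omega)] at hK
      simpa using hK v (by simp)
  · intro s t b c hst htj hA hs ht
    rw [← List.append_assoc] at hs ht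
    have hlen : (x ++ l).length = j + 1 + l.length := by simp [hx]
    rcases lt_or_ge t (x ++ l).length with htl | htl
    · rw [List.getElem?_append_left (by omega)] at hs ht
      exact h3 s t b c hst htj hA hs ht
    · rw [List.getElem?_append_right htl] at ht
      obtain ⟨h4, rfl⟩ := List.getElem?_eq_some_iff.1 ht
      simp only [List.length_singleton] at h4
      rw [List.getElem?_append_left (by omega)] at hs
      simp only [List.getElem_singleton]
      apply hK
      split_ifs with hlA
      · refine List.mem_iff_getElem?.2 ⟨s - l.length, ?_⟩
        rw [List.getElem?_drop, ← hs]
        congr 1; omega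
      · refine List.mem_cons_of_mem _ (List.mem_iff_getElem?.2 ⟨s - (l.length + 1), ?_⟩)
        rw [List.getElem?_drop, ← hs]
        congr 1; omega

/-- Each step prescribes `j + 1` neighbours: at first the preceding vertices, later `v` in place of
the oldest of them. -/
theorem le_ncard_isLead [Fintype V] {G : SimpleGraph V} {X Y : Set V} {j A N : ℕ} {x : List V}
    {v : V} {β : ℝ} (hβ : 0 ≤ β) (hXY : X ⊆ Y) (hG : HasCommonNbrs G X Y (j + 1) β)
    (hx : x.length = j + 1) (hxY : ∀ a ∈ x, a ∈ Y) (hadj : x.Pairwise G.Adj) (hv : v ∈ Y) :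
    β ^ N ≤ {g : Fin N → V | IsLead G X j A x v (List.ofFn g)}.ncard := by
  refine le_ncard_greedy hβ _ N (isLead_nil hadj) fun l hl hQ => ?_
  have hmem : ∀ a ∈ x ++ l, a ∈ Y := by
    intro a ha
    rcases List.mem_append.1 ha with ha | ha
    exacts [hxY a ha, hXY (hQ.1 a ha)]
  refine (hG (if l.length < A then (x ++ l).drop l.length
      else v :: (x ++ l).drop (l.length + 1)) ?_ ?_).trans ?_
  · split_ifs <;> simp <;> omega
  · intro a ha
    split_ifs at ha
    · exact hmem a (List.mem_of_mem_drop ha)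
    · rcases List.mem_cons.1 ha with rfl | ha
      exacts [hv, hmem a (List.mem_of_mem_drop ha)]
  · rw [Nat.cast_le]
    exact Set.ncard_le_ncard fun a ha => hQ.concat hx ha.1 ha.2

/-- Trading the oldest neighbour for the hub costs exactly the pair at distance `j + 1`, and that
pair is exempt. The `j + 1 + e` complete steps at the start ensure that the earlier member of such a
pair belongs to the approach and not to `x`. -/
theorem IsLead.powWalk {G : SimpleGraph V} {X : Set V} {j e : ℕ} {x : List V} {f : ι → V}
    {L : Fin (j + 1 + e + j) → ι} {w : ι} {M : List (ι × ι)} (hx : x.length = j + 1)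
    (h : IsLead G X j (j + 1 + e) x (f w) (List.ofFn (f ∘ L)))
    (hM : ∀ p ∈ leadMatching j e L w, p ∈ M) :
    PowWalk (LinkRel G M) (j + 1)
      (plain x ++ labelled f (List.ofFn L) ++ labelled f [w]) := by
  obtain ⟨h1, h2, h3⟩ := h
  set l : List (V × Option ι) := plain x ++ labelled f (List.ofFn L) with hl
  have hlen : l.length = j + 1 + (j + 1 + e + j) := by
    simp [hl, plain, labelled, hx]
  have hfst : l.map Prod.fst = x ++ List.ofFn (f ∘ L) := by
    simp [hl, plain, labelled, Function.comp_def]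
  have hv : ∀ (s : ℕ) (p), l[s]? = some p → (x ++ List.ofFn (f ∘ L))[s]? = some p.1 := by
    intro s p hs
    rw [← hfst, List.getElem?_map, hs]
    rfl
  have htag : ∀ (s : ℕ) (p) (hs' : s - (j + 1) < j + 1 + e + j), j + 1 ≤ s → l[s]? = some p →
      p = (f (L ⟨s - (j + 1), hs'⟩), some (L ⟨s - (j + 1), hs'⟩)) := by
    intro s p hs' hj hs
    rw [hl, List.getElem?_append_right (by simp [plain, hx, hj])] at hs
    simp only [plain, labelled, List.length_map, hx, List.getElem?_map, Option.map_eq_some_iff] at hs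
    obtain ⟨i, hi, rfl⟩ := hs
    rw [List.getElem?_ofFn, dif_pos hs', Option.some.injEq] at hi
    rw [hi]
  have hM1 : ∀ i (hi : i < j), (L ⟨e + i, by omega⟩, L ⟨j + 1 + e + i, by omega⟩) ∈ M :=
    fun i hi => hM _ (List.mem_append_left _ ((List.mem_ofFn' _ _).2 ⟨⟨i, hi⟩, rfl⟩))
  have hM2 : (L ⟨e + j, by omega⟩, w) ∈ M := hM _ (List.mem_append_right _ (by simp))
  intro s t p q hst htj hs ht
  have htl : t < (l ++ labelled f [w]).length := (List.getElem?_eq_some_iff.1 ht).1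
  simp only [List.length_append, hlen, labelled, List.length_map, List.length_singleton] at htl
  rw [List.getElem?_append_left (by omega)] at hs
  rcases lt_or_ge t l.length with htl' | htl'
  · rw [List.getElem?_append_left (by omega)] at ht
    by_cases hcase : t ≤ s + j ∨ t < j + 1 + (j + 1 + e)
    · exact Or.inl (h3 s t _ _ hst (by omega) hcase (hv _ _ hs) (hv _ _ ht))
    · right
      have hp := htag s p (by omega) (by omega) hs
      have hq := htag t q (by omega) (by omega) ht
      refine ⟨_, hM1 (t - (j + 1) - (j + 1 + e)) (by omega), Or.inl ?_⟩
      rw [hp, hq]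
      simp only [Option.some.injEq]
      constructor
      · congr 2; omega
      · congr 2; omega
  · rw [List.getElem?_append_right htl'] at ht
    have htt : t = j + 1 + (j + 1 + e + j) := by omega
    have : t - l.length = 0 := by omega
    rw [this] at ht
    simp only [labelled, List.map_cons, List.map_nil, List.getElem?_cons_zero,
      Option.some.injEq] at ht
    subst ht
    have hp := htag s p (by omega) (by omega) hs
    by_cases hs1 : s = t - (j + 1)
    · right
      refine ⟨_, hM2, Or.inl ?_⟩
      rw [hp]
      simp only [Option.some.injEq, and_true]
      congr 2; omega
    · left
      rw [hp]
      refine (h2 (s - (j + 1)) _ ?_ (by omega)).symm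
      rw [List.getElem?_ofFn, dif_pos (by omega)]
      rfl

end Connecting

/-- There is a pattern of inner vertices through which any two `(j + 1)`-cliques can be joined by
many `(j + 1)`-paths, provided that any `j + 1` vertices have many common neighbours; the pairs of
a matching `M` of the pattern are not required to be adjacent. -/
def Connectable (j : ℕ) : Prop :=
  ∃ (ι : Type) (_ : Fintype ι) (_ : DecidableEq ι) (π : List ι) (M : List (ι × ι)) (q : ℕ),
    π.Nodup ∧ IsMatchingList M ∧ 1 ≤ q ∧ π.length = (j + 2) * q ∧
    ∀ α : ℝ, 0 < α → ∃ c : ℝ, 0 < c ∧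
      ∀ (V : Type) [Fintype V] (G : SimpleGraph V) (X Y : Set V), X ⊆ Y →
        HasCommonNbrs G X Y (j + 1) (α * Fintype.card V) →
        ∀ x z : List V, x.length = j + 1 → z.length = j + 1 → (∀ a ∈ x, a ∈ Y) →
          (∀ a ∈ z, a ∈ Y) → x.Pairwise G.Adj → z.Pairwise G.Adj →
          c * (Fintype.card V : ℝ) ^ Fintype.card ι ≤
            {f : ι → V | (∀ i, f i ∈ X) ∧ PowWalk (LinkRel G M) (j + 1)
              (plain x ++ labelled f π ++ plain z)}.ncard

/-- One neighbour of each end is chosen independently; the edge between the two is the exempt pair.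
-/
theorem connectable_zero : Connectable 0 := by
  refine ⟨Bool, inferInstance, inferInstance, [false, true], [(false, true)], 1, by simp,
    by simp [IsMatchingList], le_rfl, rfl, fun α hα => ⟨α * α, by positivity, ?_⟩⟩
  intro V _ G X Y hXY hG x z hx hz hxY hzY _ _
  obtain ⟨x, rfl⟩ := List.length_eq_one_iff.1 hx
  obtain ⟨z, rfl⟩ := List.length_eq_one_iff.1 hz
  have h1 := hG [x] (by simp) hxY
  have h2 := hG [z] (by simp) hzY
  have h3 := mul_le_ncard_of_fiber (T := {w | w ∈ X ∧ ∀ a ∈ [x], G.Adj a w})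
    (S := {p : V × V | (p.1 ∈ X ∧ G.Adj x p.1) ∧ (p.2 ∈ X ∧ G.Adj z p.2)})
    (c₂ := α * Fintype.card V) (by positivity) h1 (by
      intro a ha
      refine h2.trans ?_
      rw [Nat.cast_le]
      refine Set.ncard_le_ncard ?_
      intro b hb
      exact ⟨⟨ha.1, ha.2 x (by simp)⟩, hb.1, hb.2 z (by simp)⟩)
  refine le_trans (le_of_eq ?_) (h3.trans ?_)
  · simp; ring
  · rw [Nat.cast_le]
    refine Set.ncard_le_ncard_of_injOn (fun p b => if b then p.2 else p.1) ?_ ?_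
    · rintro ⟨a, b⟩ ⟨⟨ha, hxa⟩, hb, hzb⟩
      refine ⟨by rintro (_ | _) <;> simpa, ?_⟩
      simp only [plain, labelled, List.map_cons, List.map_nil, List.cons_append, List.nil_append,
        powWalk_cons, List.take_succ_cons, List.take_zero, List.mem_singleton, forall_eq,
        Bool.false_eq_true, if_false, if_true, List.take_nil]
      refine ⟨Or.inl hxa, Or.inr ⟨(false, true), by simp, by simp⟩, Or.inl hzb.symm, ?_, powWalk_nil⟩
      simp
    · rintro ⟨a, b⟩ - ⟨a', b'⟩ - h
      have h1 := congrFun h false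
      have h2 := congrFun h true
      simp only [Bool.false_eq_true, if_false, if_true] at h1 h2
      rw [h1, h2]

/-! ### The inductive step for connections -/

section Step

variable {V ι : Type} {i q : ℕ}

/-- The labels of the pattern for `j = i + 1`: copies of a hub vertex, the approaches to its
neighbourhood from the left and from the right, and the pattern for `i`. -/
abbrev StepLabel (ι : Type) (i q : ℕ) : Type :=
  Fin (q + 1) ⊕ (Fin (i + 1 + 1 + 2 + (i + 1)) ⊕ (Fin (i + 1 + 1 + 3 + (i + 1)) ⊕ ι))

/-- The label of a copy of the hub vertex. -/
def hub (s : Fin (q + 1)) : StepLabel ι i q := Sum.inl s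

/-- A label of the left approach. -/
def leftLead (a : Fin (i + 1 + 1 + 2 + (i + 1))) : StepLabel ι i q := Sum.inr (Sum.inl a)

/-- A label of the right approach. -/
def rightLead (a : Fin (i + 1 + 1 + 3 + (i + 1))) : StepLabel ι i q :=
  Sum.inr (Sum.inr (Sum.inl a))

/-- A label of the inner pattern. -/
def core (a : ι) : StepLabel ι i q := Sum.inr (Sum.inr (Sum.inr a))

/-- The pattern for `i + 1` built from a pattern `π` for `i`. -/
def stepPattern (i q : ℕ) (π : List ι) : List (StepLabel ι i q) :=
  List.ofFn leftLead ++ (hub 0 :: insertEvery (i + 1 + 1) (List.ofFn fun s : Fin q => hub s.succ)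
    (π.map core)) ++ (List.ofFn rightLead).reverse

/-- The matching for `i + 1` built from a matching `M` for `i`. -/
def stepMatching (i q : ℕ) (M : List (ι × ι)) : List (StepLabel ι i q × StepLabel ι i q) :=
  leadMatching (i + 1) 2 leftLead (hub 0) ++
    (leadMatching (i + 1) 3 rightLead (hub (Fin.last q)) ++ M.map (Prod.map core core))

theorem isMatchingList_stepMatching {M : List (ι × ι)} (hM : IsMatchingList M) (hq : 1 ≤ q) :
    IsMatchingList (stepMatching i q M) := by
  have hinj1 : Function.Injective (leftLead : _ → StepLabel ι i q) :=
    Sum.inr_injective.comp Sum.inl_injective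
  have hinj2 : Function.Injective (rightLead : _ → StepLabel ι i q) :=
    Sum.inr_injective.comp (Sum.inr_injective.comp Sum.inl_injective)
  have hinj3 : Function.Injective (core : _ → StepLabel ι i q) :=
    Sum.inr_injective.comp (Sum.inr_injective.comp Sum.inr_injective)
  -- The two approaches end at the first and the last hub copy; these must differ for their exempt
  -- pairs to be disjoint.
  have h0 : (0 : Fin (q + 1)) ≠ Fin.last q := by
    rw [ne_eq, Fin.ext_iff]; simp; omega
  refine (isMatchingList_leadMatching hinj1 (by simp [leftLead, hub])).append
    ((isMatchingList_leadMatching hinj2 (by simp [rightLead, hub])).append (hM.map hinj3)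
      (fun s => s = hub (Fin.last q) ∨ ∃ a, s = rightLead a)
      (leadMatching_support (S := fun s => s = hub (Fin.last q) ∨ ∃ a, s = rightLead a)
        (fun a => Or.inr ⟨a, rfl⟩) (Or.inl rfl)) ?_)
      (fun s => s = hub 0 ∨ ∃ a, s = leftLead a)
      (leadMatching_support (S := fun s => s = hub 0 ∨ ∃ a, s = leftLead a)
        (fun a => Or.inr ⟨a, rfl⟩) (Or.inl rfl)) ?_
  · intro e he
    obtain ⟨e, _, rfl⟩ := List.mem_map.1 he
    simp [core, hub, rightLead]
  · intro e he
    rcases List.mem_append.1 he with he | he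
    · refine leadMatching_support (S := fun s => ¬ (s = hub 0 ∨ ∃ a, s = leftLead a)) ?_ ?_ e he
      · simp [rightLead, hub, leftLead]
      · simp [hub, leftLead, h0.symm]
    · obtain ⟨e, _, rfl⟩ := List.mem_map.1 he
      simp [core, hub, leftLead]

theorem stepPattern_nodup {π : List ι} (hπ : π.Nodup) : (stepPattern i q π).Nodup := by
  have hinj1 : Function.Injective (leftLead : _ → StepLabel ι i q) :=
    Sum.inr_injective.comp Sum.inl_injective
  have hinj2 : Function.Injective (rightLead : _ → StepLabel ι i q) :=
    Sum.inr_injective.comp (Sum.inr_injective.comp Sum.inl_injective)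
  have hinj3 : Function.Injective (core : _ → StepLabel ι i q) :=
    Sum.inr_injective.comp (Sum.inr_injective.comp Sum.inr_injective)
  have hmid : (hub 0 :: insertEvery (i + 1 + 1) (List.ofFn fun s : Fin q => hub s.succ)
      (π.map core) : List (StepLabel ι i q)).Perm (List.ofFn hub ++ π.map core) := by
    rw [List.ofFn_succ, List.cons_append]
    exact (insertEvery_perm _ _ _).cons _
  have hhub : Function.Injective (hub : _ → StepLabel ι i q) := Sum.inl_injective
  rw [stepPattern, List.nodup_append, List.nodup_append, List.nodup_reverse]
  refine ⟨⟨List.nodup_ofFn.2 hinj1, hmid.nodup_iff.2 ?_, ?_⟩, List.nodup_ofFn.2 hinj2, ?_⟩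
  · rw [List.nodup_append]
    refine ⟨List.nodup_ofFn.2 hhub, hπ.map hinj3, ?_⟩
    intro a ha b hb
    obtain ⟨a, rfl⟩ := (List.mem_ofFn' _ _).1 ha
    obtain ⟨b, -, rfl⟩ := List.mem_map.1 hb
    simp [hub, core]
  · intro a ha b hb
    obtain ⟨a, rfl⟩ := (List.mem_ofFn' _ _).1 ha
    rw [hmid.mem_iff, List.mem_append] at hb
    rcases hb with hb | hb
    · obtain ⟨b, rfl⟩ := (List.mem_ofFn' _ _).1 hb
      simp [hub, leftLead]
    · obtain ⟨b, -, rfl⟩ := List.mem_map.1 hb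
      simp [leftLead, core]
  · intro a ha b hb
    obtain ⟨b, rfl⟩ := (List.mem_ofFn' _ _).1 (List.mem_reverse.1 hb)
    rw [List.mem_append, hmid.mem_iff, List.mem_append] at ha
    rcases ha with ha | ha | ha
    · obtain ⟨a, rfl⟩ := (List.mem_ofFn' _ _).1 ha
      simp [leftLead, rightLead]
    · obtain ⟨a, rfl⟩ := (List.mem_ofFn' _ _).1 ha
      simp [hub, rightLead]
    · obtain ⟨a, -, rfl⟩ := List.mem_map.1 ha
      simp [rightLead, core]

/-- The offsets `2` and `3` of the two approaches are chosen to make the total a multiple of `i +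
3`, which the next round of insertions requires. -/
theorem stepPattern_length {π : List ι} (hπ : π.length = (i + 2) * q) :
    (stepPattern i q π).length = (i + 1 + 2) * (q + 4) := by
  simp only [stepPattern, List.length_append, List.length_ofFn, List.length_cons,
    List.length_reverse, (insertEvery_perm _ _ _).length_eq, List.length_map, hπ]
  ring

/-- `f` is a good choice for the approaches and for the inner pattern with `v` as hub vertex. -/
def IsStepChoice (G : SimpleGraph V) (X : Set V) (π : List ι) (M : List (ι × ι)) (i : ℕ)
    (x z : List V) (v : V) (gL : Fin (i + 1 + 1 + 2 + (i + 1)) → V)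
    (gR : Fin (i + 1 + 1 + 3 + (i + 1)) → V) (f : ι → V) : Prop :=
  IsLead G X (i + 1) (i + 1 + 1 + 2) x v (List.ofFn gL) ∧
  IsLead G X (i + 1) (i + 1 + 1 + 3) z.reverse v (List.ofFn gR) ∧
  (∀ a, f a ∈ X ∧ G.Adj v (f a)) ∧
  PowWalk (LinkRel G M) (i + 1) (plain ((List.ofFn gL).drop (i + 1 + 1 + 2)) ++ labelled f π ++
    plain ((List.ofFn gR).drop (i + 1 + 1 + 3)).reverse)

theorem labelled_append (f : ι → V) (π ρ : List ι) :
    labelled f (π ++ ρ) = labelled f π ++ labelled f ρ := List.map_append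

theorem labelled_reverse (f : ι → V) (π : List ι) :
    labelled f π.reverse = (labelled f π).reverse := List.map_reverse

theorem plain_reverse (x : List V) :
    (plain x.reverse : List (V × Option ι)) = (plain x).reverse := List.map_reverse

theorem mem_labelled {f : ι → V} {π : List ι} {p : V × Option ι} :
    p ∈ labelled f π ↔ ∃ a ∈ π, p = (f a, some a) := by
  simp [labelled, eq_comm]

theorem IsLead.adj_of_mem_drop {G : SimpleGraph V} {X : Set V} {j A : ℕ} {x l : List V} {v a : V}
    (h : IsLead G X j A x v l) (ha : a ∈ l.drop A) : G.Adj v a := by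
  obtain ⟨p, hp⟩ := List.mem_iff_getElem?.1 ha
  rw [List.getElem?_drop] at hp
  exact h.2.1 _ a hp (by omega)

/-- The ends of the two approaches and the inner pattern form an `(i + 1)`-walk inside the common
neighbourhood of all hub copies, so inserting the copies raises its power by one. Each approach is
then glued on along its last `i + 1` vertices together with the hub copy next to them, an overlap of
the required length `i + 2`. -/
theorem powWalk_stepPattern {G : SimpleGraph V} {X : Set V} {π : List ι} {M : List (ι × ι)}
    {x z : List V} (hx : x.length = i + 1 + 1) (hz : z.length = i + 1 + 1)
    (hπ : π.length = (i + 2) * q) {h : StepLabel ι i q → V}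
    (hh : ∀ s, IsStepChoice G X π M i x z (h (hub s)) (h ∘ leftLead) (h ∘ rightLead) (h ∘ core)) :
    PowWalk (LinkRel G (stepMatching i q M)) (i + 1 + 1)
      (plain x ++ labelled h (stepPattern i q π) ++ plain z) := by
  set M' := stepMatching i q M with hM'
  set hu : Fin (q + 1) → V × Option (StepLabel ι i q) := fun s => (h (hub s), some (hub s))
  set LL : List (V × Option (StepLabel ι i q)) := labelled h (List.ofFn leftLead) with hLL
  set RR : List (V × Option (StepLabel ι i q)) := labelled h (List.ofFn rightLead) with hRR
  set U := LL.drop (i + 1 + 1 + 2) with hU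
  set U' := RR.drop (i + 1 + 1 + 3) with hU'
  set T := labelled h (π.map (core : ι → StepLabel ι i q)) with hT
  set vs := List.ofFn fun s : Fin q => hu s.succ with hvs
  have hUl : U.length = i + 1 := by simp [hU, hLL, labelled]; omega
  have hUl' : U'.length = i + 1 := by simp [hU', hRR, labelled]; omega
  have hTl : T.length = (i + 2) * q := by simp [hT, labelled, hπ]
  have hvl : vs.length = q := by simp [hvs]
  obtain ⟨La, hLa⟩ : ∃ La, LL = La ++ U := ⟨_, (List.take_append_drop _ LL).symm⟩
  obtain ⟨Ra, hRa⟩ : ∃ Ra, RR = Ra ++ U' := ⟨_, (List.take_append_drop _ RR).symm⟩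
  have hadjU : ∀ s, ∀ p ∈ U, G.Adj (hu s).1 p.1 := by
    intro s p hp
    refine (hh s).1.adj_of_mem_drop ?_
    rw [hU, hLL, labelled, ← List.map_drop] at hp
    obtain ⟨a, ha, rfl⟩ := List.mem_map.1 hp
    have := List.mem_map_of_mem (f := h) ha
    rwa [List.map_drop, List.map_ofFn] at this
  have hadjU' : ∀ s, ∀ p ∈ U', G.Adj (hu s).1 p.1 := by
    intro s p hp
    refine (hh s).2.1.adj_of_mem_drop ?_
    rw [hU', hRR, labelled, ← List.map_drop] at hp
    obtain ⟨a, ha, rfl⟩ := List.mem_map.1 hp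
    have := List.mem_map_of_mem (f := h) ha
    rwa [List.map_drop, List.map_ofFn] at this
  have hadjT : ∀ s, ∀ p ∈ T, G.Adj (hu s).1 p.1 := by
    intro s p hp
    obtain ⟨a, ha, rfl⟩ := mem_labelled.1 hp
    obtain ⟨a, -, rfl⟩ := List.mem_map.1 ha
    exact ((hh s).2.2.1 a).2
  have hleft : PowWalk (LinkRel G M') (i + 1 + 1) (plain x ++ LL ++ [hu 0]) :=
    (hh 0).1.powWalk hx fun p hp => List.mem_append_left _ hp
  have hright : PowWalk (LinkRel G M') (i + 1 + 1) ([hu (Fin.last q)] ++ RR.reverse ++ plain z) := by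
    have := ((hh (Fin.last q)).2.1.powWalk (M := M') (by simpa using hz) fun p hp =>
      List.mem_append_right _ (List.mem_append_left _ hp)).reverse fun _ _ => LinkRel.symm
    simpa [plain, labelled, hRR, hu] using this
  have hcore : PowWalk (LinkRel G M') (i + 1) (U ++ T ++ U'.reverse) := by
    refine (hh 0).2.2.2.of_forall₂
      (R := fun p p' => p.1 = p'.1 ∧ ∀ a, p.2 = some a → p'.2 = some (core a)) ?_ ?_
    · refine List.rel_append (List.rel_append ?_ ?_) ?_
      · rw [← List.map_ofFn, ← List.map_drop, hU, hLL, labelled, ← List.map_drop, plain,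
          List.map_map, List.forall₂_map_left_iff, List.forall₂_map_right_iff]
        exact List.forall₂_same.2 fun _ _ => by simp
      · rw [hT, labelled, labelled, List.map_map, List.forall₂_map_left_iff,
          List.forall₂_map_right_iff]
        exact List.forall₂_same.2 fun _ _ => by simp
      · rw [plain_reverse, List.forall₂_reverse_iff, ← List.map_ofFn, ← List.map_drop, hU', hRR,
          labelled, ← List.map_drop, plain, List.map_map, List.forall₂_map_left_iff,
          List.forall₂_map_right_iff]
        exact List.forall₂_same.2 fun _ _ => by simp
    · rintro a b a' b' ⟨ha, ha'⟩ ⟨hb, hb'⟩ (hab | ⟨e, he, hab⟩)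
      · left
        rwa [← ha, ← hb]
      · refine Or.inr ⟨Prod.map core core e,
          List.mem_append_right _ (List.mem_append_right _ (List.mem_map_of_mem he)), ?_⟩
        rcases hab with ⟨h1, h2⟩ | ⟨h1, h2⟩
        · exact Or.inl ⟨ha' _ h1, hb' _ h2⟩
        · exact Or.inr ⟨ha' _ h1, hb' _ h2⟩
  have hadjTU : ∀ s, ∀ p ∈ T ++ U'.reverse, G.Adj (hu s).1 p.1 := by
    intro s p hp
    rcases List.mem_append.1 hp with hp | hp
    exacts [hadjT s p hp, hadjU' s p (List.mem_reverse.1 hp)]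
  have hTU : (i + 1 + 1) * vs.length ≤ (T ++ U'.reverse).length := by
    rw [hvl, List.length_append, hTl]; exact Nat.le_add_right _ _
  have hmid : PowWalk (LinkRel G M') (i + 1 + 1)
      (U ++ hu 0 :: insertEvery (i + 1 + 1) vs (T ++ U'.reverse)) := by
    refine PowWalk.insert_block (T := T ++ U'.reverse) (by omega) ?_ ?_ ?_ ?_
    · have := congrArg (List.take (i + 1)) (insertEvery_take hTU)
      simpa [List.take_take] using this
    · rwa [← List.append_assoc]
    · rw [powWalk_cons, insertEvery_take hTU]
      refine ⟨fun p hp => Or.inl (hadjTU 0 p (List.mem_of_mem_take hp)),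
        PowWalk.insertEvery hTU ?_ ?_ ?_⟩
      · rw [List.length_append, List.length_reverse, hUl', hvl, hTl]
        have : (i + 1 + 1) * (q + 1) = (i + 2) * q + (i + 2) := by ring
        omega
      · rw [List.append_assoc] at hcore
        exact hcore.right
      · intro v hv p hp
        obtain ⟨s, rfl⟩ := (List.mem_ofFn' _ _).1 hv
        exact ⟨Or.inl (hadjTU _ p hp), Or.inl (hadjTU _ p hp).symm⟩
    · exact fun p hp => Or.inl (hadjU 0 p hp).symm
  have hvT : (i + 1 + 1) * vs.length = T.length := by rw [hvl, hTl]
  rw [insertEvery_append hvT] at hmid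
  obtain ⟨S, hS⟩ := cons_insertEvery_eq_concat (v := hu 0) (w := hu (Fin.last q)) hvT (by
    have : hu 0 :: vs = List.ofFn hu := by rw [List.ofFn_succ]
    rw [this, List.ofFn_succ', List.concat_eq_append, List.getLast?_concat])
  have h1 : PowWalk (LinkRel G M') (i + 1 + 1) ((plain x ++ La) ++
      (U ++ [hu 0]) ++ (insertEvery (i + 1 + 1) vs T ++ U'.reverse)) := by
    refine PowWalk.glue ?_ ?_ (by simp [hUl])
    · simpa [hLa] using hleft
    · simpa using hmid
  have h2 : PowWalk (LinkRel G M') (i + 1 + 1) ((plain x ++ LL ++ S) ++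
      ([hu (Fin.last q)] ++ U'.reverse) ++
      (Ra.reverse ++ plain z)) := by
    refine PowWalk.glue ?_ ?_ (by simp [hUl'])
    · have e : (plain x ++ LL ++ S) ++ ([hu (Fin.last q)] ++ U'.reverse) =
          plain x ++ LL ++ (S ++ [hu (Fin.last q)]) ++ U'.reverse := by simp
      rw [e, ← hS]
      simpa [hLa] using h1
    · simpa [hRa] using hright
  convert h2 using 1
  have e : labelled h (stepPattern i q π) = LL ++ (S ++ [hu (Fin.last q)]) ++ RR.reverse := by
    rw [← hS, stepPattern, labelled_append, labelled_append, labelled_reverse]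
    congr 2
    simp only [labelled, List.map_cons, insertEvery_map, List.map_ofFn, hvs, hT, hu]
    rfl
  rw [e, hRa]
  simp

/-- Adding `v` to any `i + 1` vertices shows that these have many common neighbours inside the
neighbourhood of `v`. So the count for power `i + 1` applies there, between the last vertices of the
two approaches. -/
theorem le_ncard_isStepChoice [Fintype V] [Fintype ι] [DecidableEq ι] {G : SimpleGraph V}
    {X Y : Set V} {π : List ι} {M : List (ι × ι)} {x z : List V} {α c : ℝ} (hα : 0 < α)
    (hc : 0 < c)
    (hι : ∀ (X Y : Set V), X ⊆ Y → HasCommonNbrs G X Y (i + 1) (α * Fintype.card V) →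
        ∀ x z : List V, x.length = i + 1 → z.length = i + 1 → (∀ a ∈ x, a ∈ Y) →
          (∀ a ∈ z, a ∈ Y) → x.Pairwise G.Adj → z.Pairwise G.Adj →
          c * (Fintype.card V : ℝ) ^ Fintype.card ι ≤
            {f : ι → V | (∀ i, f i ∈ X) ∧ PowWalk (LinkRel G M) (i + 1)
              (plain x ++ labelled f π ++ plain z)}.ncard)
    (hXY : X ⊆ Y) (hG : HasCommonNbrs G X Y (i + 1 + 1) (α * Fintype.card V))
    (hx : x.length = i + 1 + 1) (hz : z.length = i + 1 + 1) (hxY : ∀ a ∈ x, a ∈ Y)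
    (hzY : ∀ a ∈ z, a ∈ Y) (hxG : x.Pairwise G.Adj) (hzG : z.Pairwise G.Adj) {v : V}
    (hv : v ∈ X) :
    (α * Fintype.card V) ^ (i + 1 + 1 + 2 + (i + 1)) *
      ((α * Fintype.card V) ^ (i + 1 + 1 + 3 + (i + 1)) *
        (c * (Fintype.card V : ℝ) ^ Fintype.card ι)) ≤
    {h : Fin (i + 1 + 1 + 2 + (i + 1)) ⊕ (Fin (i + 1 + 1 + 3 + (i + 1)) ⊕ ι) → V |
      IsStepChoice G X π M i x z v (h ∘ Sum.inl) ((h ∘ Sum.inr) ∘ Sum.inl)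
        ((h ∘ Sum.inr) ∘ Sum.inr)}.ncard := by
  have hzG' : z.reverse.Pairwise G.Adj :=
    List.pairwise_reverse.2 (hzG.imp fun h => h.symm)
  -- The last `i + 1` vertices of an approach form a clique in the neighbourhood of `v`, fit to be
  -- an end of the inner connection.
  have key : ∀ (A N : ℕ) (y : List V) (g : Fin N → V), N = A + (i + 1) → y.length = i + 1 + 1 →
      IsLead G X (i + 1) A y v (List.ofFn g) →
      ((List.ofFn g).drop A).length = i + 1 ∧
      (∀ a ∈ (List.ofFn g).drop A, a ∈ Y ∩ {w | G.Adj v w}) ∧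
      ((List.ofFn g).drop A).Pairwise G.Adj := by
    intro A N y g hN hy hg
    refine ⟨by simp only [List.length_drop, List.length_ofFn]; omega, fun a ha =>
      ⟨hXY (hg.1 a (List.mem_of_mem_drop ha)), hg.adj_of_mem_drop ha⟩, ?_⟩
    rw [List.pairwise_iff_getElem]
    intro s t hs ht hst
    simp only [List.length_drop, List.length_ofFn] at hs ht
    refine hg.2.2 (i + 1 + 1 + A + s) (i + 1 + 1 + A + t) _ _ (by omega) (by omega)
      (Or.inl (by omega)) ?_ ?_
    · rw [List.getElem?_append_right (by omega), List.getElem_drop, hy,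
        ← List.getElem?_eq_getElem]
      congr 1; omega
    · rw [List.getElem?_append_right (by omega), List.getElem_drop, hy,
        ← List.getElem?_eq_getElem]
      congr 1; omega
  refine (mul_le_ncard_of_fiber (S := {p : (_ → V) × (_ ⊕ ι → V) |
      IsStepChoice G X π M i x z v p.1 (p.2 ∘ Sum.inl) (p.2 ∘ Sum.inr)}) (by positivity)
    (le_ncard_isLead (A := i + 1 + 1 + 2) (N := i + 1 + 1 + 2 + (i + 1)) (by positivity) hXY hG hx
      hxY hxG (hXY hv)) ?_).trans (le_of_eq ?_)
  · intro gL hgL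
    refine (mul_le_ncard_of_fiber (S := {p : (_ → V) × (ι → V) |
        IsStepChoice G X π M i x z v gL p.1 p.2}) (by positivity)
      (le_ncard_isLead (A := i + 1 + 1 + 3) (N := i + 1 + 1 + 3 + (i + 1)) (by positivity) hXY hG
        (by simpa using hz) (by simpa using hzY) hzG' (hXY hv)) ?_).trans (le_of_eq ?_)
    · intro gR hgR
      obtain ⟨hL1, hL2, hL3⟩ := key _ _ _ _ rfl hx hgL
      obtain ⟨hR1, hR2, hR3⟩ := key _ _ _ _ rfl (by simpa using hz) hgR
      refine (hι (X ∩ {w | G.Adj v w}) (Y ∩ {w | G.Adj v w})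
        (Set.inter_subset_inter_left _ hXY) ?_ _ _ hL1 (by simpa using hR1) hL2
        (fun a ha => hR2 a (List.mem_reverse.1 ha)) hL3
        (List.pairwise_reverse.2 (hR3.imp fun h => h.symm))).trans ?_
      · intro l hl hlY
        refine (hG (v :: l) (by simpa using hl) ?_).trans ?_
        · rintro a (_ | ⟨_, ha⟩)
          exacts [hXY hv, (hlY a ha).1]
        · rw [Nat.cast_le]
          exact Set.ncard_le_ncard fun w hw =>
            ⟨⟨hw.1, hw.2 v (by simp)⟩, fun a ha => hw.2 a (List.mem_cons_of_mem _ ha)⟩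
      · rw [Nat.cast_le]
        exact Set.ncard_le_ncard fun f hf => ⟨hgL, hgR, hf.1, hf.2⟩
    · rw [Nat.cast_inj]
      exact (ncard_sum_arrow {p : (_ → V) × (ι → V) |
        IsStepChoice G X π M i x z v gL p.1 p.2}).symm
  · rw [Nat.cast_inj]
    exact (ncard_sum_arrow {p : (_ → V) × (_ ⊕ ι → V) |
      IsStepChoice G X π M i x z v p.1 (p.2 ∘ Sum.inl) (p.2 ∘ Sum.inr)}).symm

end Step

theorem Connectable.succ {i : ℕ} (hi : Connectable i) : Connectable (i + 1) := by
  obtain ⟨ι, _, _, π, M, q, hπ, hM, hq, hlen, hι⟩ := hi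
  refine ⟨StepLabel ι i q, inferInstance, inferInstance, stepPattern i q π, stepMatching i q M,
    q + 4, stepPattern_nodup hπ, isMatchingList_stepMatching hM hq, by omega,
    stepPattern_length hlen, fun α hα => ?_⟩
  obtain ⟨c, hc, hι⟩ := hι α hα
  set N₁ := i + 1 + 1 + 2 + (i + 1) with hN₁
  set N₂ := i + 1 + 1 + 3 + (i + 1) with hN₂
  refine ⟨(α * (α ^ N₁ * (α ^ N₂ * c)) / 2) ^ (q + 1 + 1), by positivity, ?_⟩
  intro V _ G X Y hXY hG x z hx hz hxY hzY hxG hzG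
  have : Nonempty V := ⟨x.head (by rintro rfl; simp at hx)⟩
  set S : Set (V × (Fin N₁ ⊕ (Fin N₂ ⊕ ι) → V)) := {p | p.1 ∈ X ∧
    IsStepChoice G X π M i x z p.1 (p.2 ∘ Sum.inl) ((p.2 ∘ Sum.inr) ∘ Sum.inl)
      ((p.2 ∘ Sum.inr) ∘ Sum.inr)} with hS
  have h1 := mul_le_ncard_of_fiber (S := S) (T := X)
    (c₂ := (α * Fintype.card V) ^ N₁ * ((α * Fintype.card V) ^ N₂ *
        (c * (Fintype.card V : ℝ) ^ Fintype.card ι))) (by positivity)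
    (by simpa using hG [] (by simp) (by simp)) (by
      intro v hv
      refine (le_ncard_isStepChoice hα hc (hι V G) hXY hG hx hz hxY hzY hxG hzG hv).trans ?_
      rw [Nat.cast_le]
      exact Set.ncard_le_ncard fun h hh => ⟨hv, hh⟩)
  -- Passes from one hub vertex to `q + 1` copies that share all other vertices, losing only a
  -- constant factor.
  have h2 := le_ncard_blowup (S := S) (c := α * (α ^ N₁ * (α ^ N₂ * c))) (by positivity) (q + 1)
    (by
      refine le_trans (le_of_eq ?_) h1
      simp only [Fintype.card_fun, Fintype.card_sum, Fintype.card_fin, mul_pow, pow_add]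
      push_cast
      ring)
  refine le_trans (le_of_eq ?_) (h2.trans ?_)
  · have e : (Fintype.card (StepLabel ι i q)) = (q + 1) + (N₁ + (N₂ + Fintype.card ι)) := by
      simp only [StepLabel, Fintype.card_sum, Fintype.card_fin, hN₁, hN₂]
    rw [e]
    simp only [Fintype.card_fun, Fintype.card_sum, Fintype.card_fin]
    push_cast
    rw [pow_add _ (q + 1) (N₁ + _)]
    ring
  · rw [← ncard_sum_arrow, Nat.cast_le]
    refine Set.ncard_le_ncard fun h hh => ?_
    have hh : ∀ s, h (hub s) ∈ X ∧ IsStepChoice G X π M i x z (h (hub s)) (h ∘ leftLead)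
      (h ∘ rightLead) (h ∘ core) := hh
    refine ⟨?_, powWalk_stepPattern hx hz hlen fun s => (hh s).2⟩
    obtain ⟨h3, h4, h5, -⟩ := (hh 0).2
    rintro (s | a | a | a)
    · exact (hh s).1
    · exact h3.1 _ ((List.mem_ofFn' _ _).2 ⟨a, rfl⟩)
    · exact h4.1 _ ((List.mem_ofFn' _ _).2 ⟨a, rfl⟩)
    · exact (h5 a).1

theorem connectable (j : ℕ) : Connectable j := by
  induction j with
  | zero => exact connectable_zero
  | succ i ih => exact ih.succ

end PowerPath

namespace PowerPath

open MeasureTheory ProbabilityTheory unitInterval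

/-! ### Matchings in the random graph -/

section Probability

variable {V : Type*} [Fintype V]

theorem binomialRandom_disjoint_le (p : I) (S : Finset (Sym2 V)) (hS : ∀ e ∈ S, ¬ e.IsDiag) :
    SimpleGraph.binomialRandom V p {F | ∀ e ∈ S, e ∉ F.edgeSet} ≤
      ENNReal.ofReal (Real.exp (-(p * S.card))) := by
  rw [SimpleGraph.binomialRandom_apply']
  have hsub : SimpleGraph.edgeSet '' {F : SimpleGraph V | ∀ e ∈ S, e ∉ F.edgeSet} ⊆
      {s | ∀ e ∈ S, e ∉ s} := by
    rintro _ ⟨F, hF, rfl⟩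
    exact hF
  refine (measure_mono hsub).trans ?_
  rw [setBernoulli_apply']
  have hpre : (fun q : Sym2 V → Prop => {e | q e}) ⁻¹' {s | ∀ e ∈ S, e ∉ s} =
      Set.pi S fun _ => {False} := by
    ext q
    simp [Set.mem_pi]
  rw [hpre, Measure.infinitePi_pi _ (fun _ _ => MeasurableSet.of_discrete)]
  have h1 : ∀ e ∈ S, (toNNReal p • Measure.dirac (e ∈ (Sym2.diagSetᶜ : Set (Sym2 V))) +
      toNNReal (σ p) • Measure.dirac False) {False} ≤ ENNReal.ofReal (Real.exp (-p)) := by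
    intro e he
    have : e ∈ (Sym2.diagSetᶜ : Set (Sym2 V)) := by simpa using hS e he
    have hne : (True : Prop) ∉ ({False} : Set Prop) := by simp
    simp only [this, Measure.add_apply, Measure.smul_apply,
      Measure.dirac_apply' _ (MeasurableSet.of_discrete : MeasurableSet ({False} : Set Prop))]
    rw [Set.indicator_of_notMem hne, Set.indicator_of_mem (by simp)]
    have h2 : (toNNReal (σ p) : ℝ) ≤ Real.exp (-p) := by
      have := Real.one_sub_le_exp_neg (p : ℝ)
      simpa using this
    simp only [smul_zero, zero_add, Pi.one_apply, ENNReal.smul_def, smul_eq_mul, mul_one]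
    rw [← ENNReal.ofReal_coe_nnreal]
    exact ENNReal.ofReal_le_ofReal h2
  refine (Finset.prod_le_prod' h1).trans (le_of_eq ?_)
  rw [Finset.prod_const, ← ENNReal.ofReal_pow (Real.exp_pos _).le, ← Real.exp_nat_mul]
  congr 2
  ring

/-- At most `Fintype.card V` members of `E` are diagonal, and each edge comes from at most two of
the others. -/
theorem binomialRandom_avoid_le (p : I) (E : Set (V × V)) {c : ℝ}
    (hE : c * (Fintype.card V : ℝ) ^ 2 ≤ E.ncard) :
    SimpleGraph.binomialRandom V p {F | ∀ e ∈ E, ¬ F.Adj e.1 e.2} ≤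
      ENNReal.ofReal (Real.exp (-(p * ((c * (Fintype.card V : ℝ) ^ 2 - Fintype.card V) / 2)))) := by
  classical
  set E' : Finset (V × V) := E.toFinset.filter fun e => e.1 ≠ e.2 with hE'
  set S : Finset (Sym2 V) := E'.image fun e => s(e.1, e.2) with hS
  have h1 : E'.card ≤ 2 * S.card := by
    refine Finset.card_le_mul_card_image _ _ fun s _ => ?_
    induction s with | _ a b
    have : (E'.filter fun e => s(e.1, e.2) = s(a, b)) ⊆ {(a, b), (b, a)} := by
      intro e he
      have := (Finset.mem_filter.1 he).2
      rw [Sym2.eq_iff] at this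
      rcases this with ⟨h, h'⟩ | ⟨h, h'⟩ <;> simp [Prod.ext_iff, h, h']
    exact (Finset.card_le_card this).trans Finset.card_le_two
  have h2 : E.ncard ≤ E'.card + Fintype.card V := by
    rw [Set.ncard_eq_toFinset_card', ← Finset.card_filter_add_card_filter_not (fun e : V × V => e.1 ≠ e.2)]
    refine Nat.add_le_add_left ?_ _
    rw [← Finset.card_univ]
    refine Finset.card_le_card_of_injOn Prod.fst (by simp) ?_
    rintro ⟨a, b⟩ h ⟨a', b'⟩ h' hab
    simp only [ne_eq, Decidable.not_not, Finset.coe_filter, Set.mem_ofPred_eq] at h h' hab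
    rw [Prod.mk.injEq, ← h.2, ← h'.2]
    exact ⟨hab, hab⟩
  have hsub : {F : SimpleGraph V | ∀ e ∈ E, ¬ F.Adj e.1 e.2} ⊆ {F | ∀ e ∈ S, e ∉ F.edgeSet} := by
    intro F hF e he
    obtain ⟨⟨a, b⟩, hab, rfl⟩ := Finset.mem_image.1 he
    exact hF (a, b) (by simpa using (Finset.mem_filter.1 hab).1)
  refine (measure_mono hsub).trans ((binomialRandom_disjoint_le p S ?_).trans ?_)
  · intro e he
    obtain ⟨⟨a, b⟩, hab, rfl⟩ := Finset.mem_image.1 he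
    simpa using (Finset.mem_filter.1 hab).2
  · refine ENNReal.ofReal_le_ofReal (Real.exp_le_exp.2 (neg_le_neg ?_))
    have hp : (0 : ℝ) ≤ p := p.2.1
    refine mul_le_mul_of_nonneg_left ?_ hp
    have h3 : (E.ncard : ℝ) ≤ 2 * S.card + Fintype.card V := by exact_mod_cast h2.trans (by omega)
    linarith

variable {ι : Type*} [Fintype ι] [DecidableEq ι]

/-- Call a position of the first pair rich if many placements in `F` extend it. Failure means that
no rich position is an edge, or that for some rich position the remaining pairs fail on all its
extensions. The former is exponentially unlikely and the latter is bounded by induction and a union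
bound over the positions. No independence between different pairs of `M` is used; disjointness
ensures that fixing the first pair leaves the others alone. -/
theorem binomialRandom_no_matching_le [Nonempty V] (p : I) (M : List (ι × ι))
    (hM : IsMatchingList M) {c : ℝ} (hc : 0 < c) (F : Set (ι → V))
    (hF : c * (Fintype.card V : ℝ) ^ Fintype.card ι ≤ F.ncard) :
    SimpleGraph.binomialRandom V p {H | ¬ ∃ f ∈ F, ∀ e ∈ M, H.Adj (f e.1) (f e.2)} ≤
      ENNReal.ofReal ((1 + (Fintype.card V : ℝ) ^ 2) ^ M.length *
        Real.exp (-(p * ((c / 2 ^ M.length * (Fintype.card V : ℝ) ^ 2 - Fintype.card V) / 2)))) := by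
  classical
  have hn : (0 : ℝ) < Fintype.card V := by exact_mod_cast Fintype.card_pos
  have hp : (0 : ℝ) ≤ p := p.2.1
  induction M generalizing c F with
  | nil =>
    have : 0 < F.ncard := by
      have : (0 : ℝ) < F.ncard := lt_of_lt_of_le (by positivity) hF
      exact_mod_cast this
    obtain ⟨f, hf⟩ := (Set.ncard_pos).1 this
    have : {H : SimpleGraph V | ¬ ∃ f ∈ F, ∀ e ∈ ([] : List (ι × ι)), H.Adj (f e.1) (f e.2)} = ∅ := by
      ext H
      simpa using ⟨f, hf⟩
    rw [this]
    simp
  | cons e M ih =>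
    have hM' : IsMatchingList M :=
      ⟨fun e he => hM.1 e (List.mem_cons_of_mem _ he), (List.pairwise_cons.1 hM.2).2⟩
    have hdisj := (List.pairwise_cons.1 hM.2).1
    have he : e.1 ≠ e.2 := hM.1 e (by simp)
    set S : Set ((V × V) × (ι → V)) := {x | Function.update (Function.update x.2 e.1 x.1.1) e.2 x.1.2 ∈ F}
      with hS
    set n : ℝ := ((Fintype.card V : ℕ) : ℝ) with hn'
    have h1 : c * Fintype.card (V × V) * Fintype.card (ι → V) ≤ S.ncard := by
      have : ((Fintype.card V ^ 2 * F.ncard : ℕ) : ℝ) ≤ S.ncard := by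
        exact_mod_cast ncard_update_pair (V := V) (F := F) he
      refine le_trans ?_ this
      simp only [Fintype.card_prod, Fintype.card_fun]
      push_cast
      rw [← hn']
      nlinarith [mul_le_mul_of_nonneg_left hF (sq_nonneg n)]
    have h2 := le_ncard_rich_fiber hc.le h1
    set Φ : Set (V × V) := {a | c / 2 * Fintype.card (ι → V) ≤ ({b | (a, b) ∈ S}.ncard : ℝ)}
    have hsub : {H : SimpleGraph V | ¬ ∃ f ∈ F, ∀ e' ∈ e :: M, H.Adj (f e'.1) (f e'.2)} ⊆
        {H | ∀ a ∈ Φ, ¬ H.Adj a.1 a.2} ∪ ⋃ a ∈ Φ.toFinset,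
          {H | ¬ ∃ f ∈ {f | (a, f) ∈ S}, ∀ e' ∈ M, H.Adj (f e'.1) (f e'.2)} := by
      intro H hH
      by_contra hcon
      simp only [Set.mem_union, Set.mem_iUnion, not_or, not_exists, Set.mem_ofPred_eq, not_forall,
        not_not, Set.mem_toFinset] at hcon
      obtain ⟨⟨a, ha, hHa⟩, hcon⟩ := hcon
      obtain ⟨f, hf, hfM⟩ := hcon a ha
      refine hH ⟨_, hf, ?_⟩
      intro e' he'
      rcases List.mem_cons.1 he' with rfl | he'
      · simpa [Function.update_of_ne he] using hHa
      · obtain ⟨d1, d2, d3, d4⟩ := hdisj e' he'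
        simpa [Function.update_of_ne d1.symm, Function.update_of_ne d2.symm,
          Function.update_of_ne d3.symm, Function.update_of_ne d4.symm] using hfM e' he'
    refine (measure_mono hsub).trans ((measure_union_le _ _).trans ?_)
    set X := Real.exp (-(p * ((c / 2 ^ (M.length + 1) * n ^ 2 - n) / 2))) with hX
    have hX0 : 0 < X := Real.exp_pos _
    have hA : SimpleGraph.binomialRandom V p {H | ∀ a ∈ Φ, ¬ H.Adj a.1 a.2} ≤ ENNReal.ofReal X := by
      refine (binomialRandom_avoid_le p Φ (c := c / 2) ?_).trans ?_
      · refine le_trans (le_of_eq ?_) h2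
        simp only [Fintype.card_prod]
        push_cast
        ring
      · refine ENNReal.ofReal_le_ofReal (Real.exp_le_exp.2 (neg_le_neg ?_))
        refine mul_le_mul_of_nonneg_left ?_ hp
        have : c / 2 ^ (M.length + 1) ≤ c / 2 := by
          refine div_le_div_of_nonneg_left hc.le (by norm_num) ?_
          exact le_self_pow₀ (by norm_num) (by simp)
        have := mul_le_mul_of_nonneg_right this (sq_nonneg n)
        linarith
    have hB : ∀ a ∈ Φ.toFinset, SimpleGraph.binomialRandom V p
        {H | ¬ ∃ f ∈ {f | (a, f) ∈ S}, ∀ e' ∈ M, H.Adj (f e'.1) (f e'.2)} ≤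
        ENNReal.ofReal ((1 + n ^ 2) ^ M.length * X) := by
      intro a ha
      have haΦ : a ∈ Φ := Set.mem_toFinset.1 ha
      have ha' : c / 2 * Fintype.card (ι → V) ≤ ({b | (a, b) ∈ S}.ncard : ℝ) :=
        haΦ
      rw [Fintype.card_fun, Nat.cast_pow] at ha'
      refine (ih hM' (half_pos hc) _ ha').trans (le_of_eq ?_)
      rw [hX, pow_succ' (2 : ℝ) M.length, div_div]
    refine (add_le_add hA ((measure_biUnion_finset_le _ _).trans (Finset.sum_le_sum hB))).trans ?_
    rw [Finset.sum_const, nsmul_eq_mul, ← ENNReal.ofReal_natCast, ← ENNReal.ofReal_mul (by positivity),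
      ← ENNReal.ofReal_add (by positivity) (by positivity)]
    refine ENNReal.ofReal_le_ofReal ?_
    have hΦ : (Φ.toFinset.card : ℝ) ≤ n ^ 2 := by
      have := Finset.card_le_univ Φ.toFinset
      rw [Fintype.card_prod] at this
      rw [hn', sq]
      exact_mod_cast this
    have h3 : (1 : ℝ) ≤ (1 + n ^ 2) ^ M.length := one_le_pow₀ (by nlinarith)
    rw [List.length_cons, pow_succ (1 + n ^ 2), ← hX]
    have h4 : (Φ.toFinset.card : ℝ) * ((1 + n ^ 2) ^ M.length * X) ≤
        n ^ 2 * ((1 + n ^ 2) ^ M.length * X) := by gcongr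
    nlinarith

end Probability

/-- The factor `4 ^ n` allows two arbitrary vertex sets in the index and `n ^ d` allows `d` further
vertices. The union bound works because each family fails with probability at most a polynomial
times `exp (-3 * n)`, and `4 * exp (-3) < 1`. -/
theorem tendsto_exists_no_matching {ι : Type*} [Fintype ι] [DecidableEq ι] (M : List (ι × ι))
    (hM : IsMatchingList M) {c : ℝ} (hc : 0 < c) (d : ℕ) :
    ∃ C : ℝ, ∀ (p : ℕ → I) (J : ℕ → Type) [∀ n, Fintype (J n)]
      (F : ∀ n, J n → Set (ι → Fin n)),
      (∀ᶠ n : ℕ in Filter.atTop, C / (n : ℝ) ≤ p n) →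
      (∀ n : ℕ, (Fintype.card (J n)) ≤ 4 ^ n * n ^ d) →
      Filter.Tendsto (fun n => SimpleGraph.binomialRandom (Fin n) (p n)
        {H | ¬ ∀ i, c * (n : ℝ) ^ Fintype.card ι ≤ (F n i).ncard →
          ∃ f ∈ F n i, Function.Injective f ∧ ∀ e ∈ M, H.Adj (f e.1) (f e.2)})
        Filter.atTop (nhds 0) := by
  classical
  -- The density is halved once for injectivity and once for each pair of `M`.
  set c' : ℝ := c / 2 / 2 ^ M.length with hc'
  have hc'0 : 0 < c' := by positivity
  -- For large `n` the exponent is at least `(12 / (c' n)) * (c' n² / 4) = 3 n`.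
  refine ⟨12 / c', fun p J _ F hp hJ => ?_⟩
  set r := M.length
  have hlim : Filter.Tendsto (fun n : ℕ => ENNReal.ofReal
      (2 ^ r * ((n : ℝ) ^ (d + 2 * r) * (4 * Real.exp (-3)) ^ n))) Filter.atTop (nhds 0) := by
    have h1 : |4 * Real.exp (-3)| < 1 := by
      rw [abs_of_pos (by positivity), Real.exp_neg, ← div_eq_mul_inv, div_lt_one (Real.exp_pos 3)]
      have := Real.add_one_lt_exp (x := 3) (by norm_num)
      linarith
    have h2 := (tendsto_pow_const_mul_const_pow_of_abs_lt_one (d + 2 * r) h1).const_mul (2 ^ r)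
    have h3 := ENNReal.tendsto_ofReal h2
    simpa using h3
  refine tendsto_of_tendsto_of_tendsto_of_le_of_le' tendsto_const_nhds hlim
    (Filter.Eventually.of_forall fun _ => zero_le) ?_
  filter_upwards [hp, Filter.eventually_ge_atTop 1,
    tendsto_natCast_atTop_atTop.eventually_ge_atTop (2 * (Fintype.card ι : ℝ) ^ 2 / c),
    tendsto_natCast_atTop_atTop.eventually_ge_atTop (2 / c')] with n hpn hn1 hnι hnc
  have : NeZero n := ⟨by omega⟩
  have hn0 : (0 : ℝ) < n := by exact_mod_cast hn1
  set J' : Finset (J n) := Finset.univ.filter fun i => c * (n : ℝ) ^ Fintype.card ι ≤ (F n i).ncard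
  have hsub : {H : SimpleGraph (Fin n) | ¬ ∀ i, c * (n : ℝ) ^ Fintype.card ι ≤ (F n i).ncard →
      ∃ f ∈ F n i, Function.Injective f ∧ ∀ e ∈ M, H.Adj (f e.1) (f e.2)} ⊆
      ⋃ i ∈ J', {H | ¬ ∃ f ∈ {f ∈ F n i | Function.Injective f},
        ∀ e ∈ M, H.Adj (f e.1) (f e.2)} := by
    intro H hH
    simp only [Set.mem_ofPred_eq, not_forall] at hH
    obtain ⟨i, hi, hno⟩ := hH
    simp only [Set.mem_iUnion]
    refine ⟨i, by simpa [J'] using hi, ?_⟩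
    rintro ⟨f, ⟨hf, hinj⟩, hfM⟩
    exact hno ⟨f, hf, hinj, hfM⟩
  refine (measure_mono hsub).trans ((measure_biUnion_finset_le _ _).trans ?_)
  have hB : ∀ i ∈ J', SimpleGraph.binomialRandom (Fin n) (p n)
      {H | ¬ ∃ f ∈ {f ∈ F n i | Function.Injective f}, ∀ e ∈ M, H.Adj (f e.1) (f e.2)} ≤
      ENNReal.ofReal ((1 + (n : ℝ) ^ 2) ^ r * Real.exp (-3) ^ n) := by
    intro i hi
    have hi' : c * (n : ℝ) ^ Fintype.card ι ≤ (F n i).ncard := by simpa [J'] using hi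
    have hinj := le_ncard_injective (F := F n i) hc (by simpa using hnι) (by simpa using (by omega : 0 < n))
      (by simpa using hi')
    refine (binomialRandom_no_matching_le (p n) M hM (half_pos hc) _ hinj).trans ?_
    refine ENNReal.ofReal_le_ofReal ?_
    rw [Fintype.card_fin, ← Real.exp_nat_mul]
    refine mul_le_mul_of_nonneg_left (Real.exp_le_exp.2 ?_) (by positivity)
    rw [mul_neg, neg_le_neg_iff]
    have h1 : (n : ℝ) ≤ c' * n ^ 2 / 2 := by
      rw [div_le_iff₀ hc'0] at hnc
      nlinarith
    have h2 : 12 / c' / n * (c' * n ^ 2 / 4) ≤ p n * ((c' * n ^ 2 - n) / 2) :=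
      mul_le_mul hpn (by linarith) (by positivity) (p n).2.1
    refine le_trans (le_of_eq ?_) h2
    field_simp
    norm_num
  refine (Finset.sum_le_sum hB).trans ?_
  rw [Finset.sum_const, nsmul_eq_mul, ← ENNReal.ofReal_natCast, ← ENNReal.ofReal_mul (by positivity)]
  refine ENNReal.ofReal_le_ofReal ?_
  have h1 : (J'.card : ℝ) ≤ 4 ^ n * (n : ℝ) ^ d := by
    exact_mod_cast (Finset.card_le_univ _).trans (hJ n)
  have h2 : (1 + (n : ℝ) ^ 2) ^ r ≤ 2 ^ r * (n : ℝ) ^ (2 * r) := by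
    rw [pow_mul, ← mul_pow]
    refine pow_le_pow_left₀ (by positivity) ?_ _
    have : (1 : ℝ) ≤ n := by exact_mod_cast hn1
    nlinarith
  calc (J'.card : ℝ) * ((1 + (n : ℝ) ^ 2) ^ r * Real.exp (-3) ^ n) ≤
      (4 ^ n * (n : ℝ) ^ d) * ((2 ^ r * (n : ℝ) ^ (2 * r)) * Real.exp (-3) ^ n) := by gcongr
    _ = _ := by rw [mul_pow, pow_add]; ring

end PowerPath

namespace PowerPath

/-! ### Small families of absorbers -/

section Absorbers

variable {V : Type*} [DecidableEq V]

/-- The first and the second half of an `m`-path on `2 m` vertices. -/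
def IsAbsorber (H : SimpleGraph V) (m : ℕ) (T : List V × List V) : Prop :=
  T.1.length = m ∧ T.2.length = m ∧ (T.1 ++ T.2).Nodup ∧ PowWalk H.Adj m (T.1 ++ T.2)

/-- `v` is adjacent to all vertices of `T`. -/
def Absorbs (H : SimpleGraph V) (T : List V × List V) (v : V) : Prop :=
  ∀ u ∈ T.1 ++ T.2, H.Adj v u

/-- Outside any small set there is an absorber for a proportion `c` of the vertices of any
nonempty set. -/
def HasAbsorbers [Fintype V] (H : SimpleGraph V) (m : ℕ) (c β : ℝ) : Prop :=
  ∀ R : Finset V, (R.card : ℝ) ≤ β * Fintype.card V → ∀ W : Finset V, W.Nonempty →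
    ∃ T : List V × List V, IsAbsorber H m T ∧ (∀ a ∈ T.1 ++ T.2, a ∉ R) ∧
      c * W.card ≤ {v | v ∈ W ∧ Absorbs H T v}.ncard

/-- A set of disjoint absorbers outside `R`. -/
def IsFamily (H : SimpleGraph V) (m : ℕ) (R : Finset V) (𝓐 : Finset (List V × List V)) : Prop :=
  (∀ T ∈ 𝓐, IsAbsorber H m T ∧ ∀ a ∈ T.1 ++ T.2, a ∉ R) ∧
    ∀ T ∈ 𝓐, ∀ T' ∈ 𝓐, T ≠ T' → (T.1 ++ T.2).Disjoint (T'.1 ++ T'.2)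

/-- The vertices of the absorbers in a set. -/
def familyVerts (𝓐 : Finset (List V × List V)) : Finset V :=
  𝓐.biUnion fun T => (T.1 ++ T.2).toFinset

theorem mem_familyVerts {𝓐 : Finset (List V × List V)} {a : V} :
    a ∈ familyVerts 𝓐 ↔ ∃ T ∈ 𝓐, a ∈ T.1 ++ T.2 := by
  simp [familyVerts]

/-- Distinct absorbers can be assigned to the elements of `U`. -/
def CanAbsorb (H : SimpleGraph V) (𝓐 : Finset (List V × List V)) (U : Finset V) : Prop :=
  ∃ φ : V → List V × List V, Set.InjOn φ U ∧ ∀ v ∈ U, φ v ∈ 𝓐 ∧ Absorbs H (φ v) v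

variable {H : SimpleGraph V} {m : ℕ} {R : Finset V} {c β : ℝ}

theorem IsFamily.card_verts_le {𝓐 : Finset (List V × List V)} (h : IsFamily H m R 𝓐) :
    (familyVerts 𝓐).card ≤ 2 * m * 𝓐.card := by
  refine (Finset.card_biUnion_le).trans ?_
  rw [mul_comm]
  refine Finset.sum_le_card_nsmul _ _ _ fun T hT => ?_
  obtain ⟨h1, h2, -⟩ := (h.1 T hT).1
  refine (List.toFinset_card_le _).trans ?_
  rw [List.length_append, h1, h2, two_mul]

theorem IsFamily.union {𝓐 𝓑 : Finset (List V × List V)} (hA : IsFamily H m R 𝓐)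
    (hB : IsFamily H m (R ∪ familyVerts 𝓐) 𝓑) : IsFamily H m R (𝓐 ∪ 𝓑) := by
  have hcross : ∀ T ∈ 𝓐, ∀ T' ∈ 𝓑, (T.1 ++ T.2).Disjoint (T'.1 ++ T'.2) := by
    intro T hT T' hT' a ha ha'
    exact (hB.1 T' hT').2 a ha' (Finset.mem_union_right _ (mem_familyVerts.2 ⟨T, hT, ha⟩))
  constructor
  · intro T hT
    rcases Finset.mem_union.1 hT with hT | hT
    · exact hA.1 T hT
    · exact ⟨(hB.1 T hT).1, fun a ha haR => (hB.1 T hT).2 a ha (Finset.mem_union_left _ haR)⟩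
  · intro T hT T' hT' hne
    rcases Finset.mem_union.1 hT with hT | hT <;> rcases Finset.mem_union.1 hT' with hT' | hT'
    · exact hA.2 T hT T' hT' hne
    · exact hcross T hT T' hT'
    · exact (hcross T' hT' T hT).symm
    · exact hB.2 T hT T' hT' hne

theorem IsFamily.disjoint {𝓐 𝓑 : Finset (List V × List V)} (hm : 1 ≤ m)
    (hB : IsFamily H m (R ∪ familyVerts 𝓐) 𝓑) : Disjoint 𝓐 𝓑 := by
  rw [Finset.disjoint_left]
  intro T hT hT'
  obtain ⟨⟨h1, -⟩, h2⟩ := hB.1 T hT'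
  obtain ⟨a, ha⟩ := List.exists_mem_of_length_pos (l := T.1) (by omega)
  have ha' : a ∈ T.1 ++ T.2 := List.mem_append_left _ ha
  exact h2 a ha' (Finset.mem_union_right _ (mem_familyVerts.2 ⟨T, hT, ha'⟩))

/-- The number of absorbers for `v` in a set. -/
noncomputable def coverage (H : SimpleGraph V) (𝓐 : Finset (List V × List V)) (v : V) : ℕ :=
  {T | T ∈ 𝓐 ∧ Absorbs H T v}.ncard

theorem finite_coverage {V : Type*} {H : SimpleGraph V} (𝓐 : Finset (List V × List V)) (v : V) :
    {T | T ∈ 𝓐 ∧ Absorbs H T v}.Finite :=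
  𝓐.finite_toSet.subset fun _ h => h.1

theorem coverage_union {𝓐 : Finset (List V × List V)} {T : List V × List V} (hT : T ∉ 𝓐) (v : V) :
    coverage H 𝓐 v ≤ coverage H (𝓐 ∪ {T}) v ∧
      (Absorbs H T v → coverage H 𝓐 v + 1 ≤ coverage H (𝓐 ∪ {T}) v) := by
  constructor
  · exact Set.ncard_le_ncard (fun T' hT' => ⟨Finset.mem_union_left _ hT'.1, hT'.2⟩)
      (finite_coverage _ _)
  · intro hTv
    rw [coverage, coverage, ← Set.ncard_insert_of_notMem (a := T) (fun h => hT h.1)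
      (finite_coverage _ _)]
    refine Set.ncard_le_ncard ?_ (finite_coverage _ _)
    rintro T' (rfl | hT')
    · exact ⟨by simp, hTv⟩
    · exact ⟨Finset.mem_union_left _ hT'.1, hT'.2⟩

/-- Every vertex of `U \ W'` has at least `U.card` absorbers in `𝓐`, so Hall's condition holds
because of any single vertex. The remaining vertices use `𝓑`, which is disjoint from `𝓐`. -/
theorem CanAbsorb.of_coverage {𝓐 𝓑 : Finset (List V × List V)} (hdisj : Disjoint 𝓐 𝓑)
    {U W' : Finset V} {t : ℕ} (hU : U.card ≤ t) (hA : ∀ v ∈ U \ W', t ≤ coverage H 𝓐 v)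
    (hB : CanAbsorb H 𝓑 (U ∩ W')) : CanAbsorb H (𝓐 ∪ 𝓑) U := by
  classical
  obtain ⟨φ, hφ1, hφ2⟩ := hB
  obtain ⟨ψ, hψ1, hψ2⟩ := (Finset.all_card_le_biUnion_card_iff_exists_injective
    (fun v : (U \ W' : Finset V) => 𝓐.filter fun T => Absorbs H T v)).1 (by
      intro s
      rcases s.eq_empty_or_nonempty with rfl | ⟨v, hv⟩
      · simp
      · have h1 : s.card ≤ t := by
          refine le_trans ?_ hU
          calc s.card ≤ Fintype.card (U \ W' : Finset V) := Finset.card_le_univ _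
            _ = (U \ W').card := Fintype.card_coe _
            _ ≤ U.card := Finset.card_le_card Finset.sdiff_subset
        have h2 := hA v v.2
        refine (h1.trans h2).trans ?_
        have : coverage H 𝓐 v = (𝓐.filter fun T => Absorbs H T v).card := by
          rw [coverage, ← Set.ncard_coe_finset]
          congr 1
          ext T; simp
        rw [this]
        exact Finset.card_le_card (Finset.subset_biUnion_of_mem
          (fun v : (U \ W' : Finset V) => 𝓐.filter fun T => Absorbs H T v) hv))
  refine ⟨fun v => if h : v ∈ U \ W' then ψ ⟨v, h⟩ else φ v, ?_, ?_⟩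
  · have hsplit : ∀ v ∈ U, v ∉ U \ W' → v ∈ U ∩ W' := by
      intro v hv h
      simp only [Finset.mem_sdiff, not_and, not_not] at h
      exact Finset.mem_inter.2 ⟨hv, h hv⟩
    have hne : ∀ v (hv : v ∈ U \ W'), ∀ w ∈ U ∩ W', ψ ⟨v, hv⟩ ≠ φ w := by
      intro v hv w hw h
      exact Finset.disjoint_left.1 hdisj (Finset.mem_filter.1 (hψ2 ⟨v, hv⟩)).1 (h ▸ (hφ2 w hw).1)
    intro v hv w hw h
    simp only at h
    split_ifs at h with h1 h2 h2
    · simpa using hψ1 h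
    · exact absurd h (hne v h1 w (hsplit w hw h2))
    · exact absurd h.symm (hne w h2 v (hsplit v hv h1))
    · exact hφ1 (hsplit v hv h1) (hsplit w hw h2) h
  · intro v hv
    by_cases h : v ∈ U \ W'
    · simp only [dif_pos h]
      have := Finset.mem_filter.1 (hψ2 ⟨v, h⟩)
      exact ⟨Finset.mem_union_left _ this.1, this.2⟩
    · simp only [dif_neg h]
      have := hφ2 v (by
        simp only [Finset.mem_sdiff, not_and, not_not] at h
        exact Finset.mem_inter.2 ⟨hv, h hv⟩)
      exact ⟨Finset.mem_union_right _ this.1, this.2⟩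

variable [Fintype V]

/-- The sum of the coverages truncated at `t` serves as a potential. While more than half of `W` is
covered fewer than `t` times, an absorber chosen for this deficient set raises the potential by at
least `c * W.card / 2`, as truncation does not affect deficient vertices. -/
theorem exists_family_step (hm : 1 ≤ m) (hH : HasAbsorbers H m c β) {W : Finset V}
    (hc : 0 < c) (t s : ℕ) (hs : (R.card : ℝ) + 2 * m * s ≤ β * Fintype.card V) :
    (∃ 𝓐, IsFamily H m R 𝓐 ∧ 𝓐.card ≤ s ∧
      ∃ W' ⊆ W, 2 * W'.card ≤ W.card ∧ ∀ v ∈ W \ W', t ≤ coverage H 𝓐 v) ∨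
    ∃ 𝓐, IsFamily H m R 𝓐 ∧ 𝓐.card = s ∧
      c * W.card / 2 * s ≤ ∑ v ∈ W, (min (coverage H 𝓐 v) t : ℕ) := by
  classical
  induction s with
  | zero =>
    refine Or.inr ⟨∅, ⟨by simp, by simp⟩, by simp, ?_⟩
    simp only [Nat.cast_zero, mul_zero]
    positivity
  | succ s ih =>
    push_cast at hs
    have hs' : (R.card : ℝ) + 2 * m * s ≤ β * Fintype.card V := by
      refine le_trans ?_ hs
      have : (0 : ℝ) ≤ m := by positivity
      nlinarith
    rcases ih hs' with ⟨𝓐, h1, h2, h3⟩ | ⟨𝓐, h1, h2, h3⟩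
    · exact Or.inl ⟨𝓐, h1, by omega, h3⟩
    set D := W.filter fun v => coverage H 𝓐 v < t with hD
    by_cases hDW : 2 * D.card ≤ W.card
    · refine Or.inl ⟨𝓐, h1, by omega, D, Finset.filter_subset _ _, hDW, ?_⟩
      intro v hv
      simp only [hD, Finset.mem_sdiff, Finset.mem_filter, not_and, not_lt] at hv
      exact hv.2 hv.1
    · have hDne : D.Nonempty := by
        rw [← Finset.card_pos]; omega
      have hR' : ((R ∪ familyVerts 𝓐).card : ℝ) ≤ β * Fintype.card V := by
        refine le_trans ?_ hs'
        have := (Finset.card_union_le R (familyVerts 𝓐)).trans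
          (Nat.add_le_add_left h1.card_verts_le _)
        rw [h2] at this
        exact_mod_cast this
      obtain ⟨T, hT1, hT2, hT3⟩ := hH _ hR' D hDne
      have hfam : IsFamily H m (R ∪ familyVerts 𝓐) {T} := by
        refine ⟨fun T' hT' => ?_, fun T' hT' T'' hT'' hne => ?_⟩
        · rw [Finset.mem_singleton] at hT'
          subst hT'
          exact ⟨hT1, hT2⟩
        · rw [Finset.mem_singleton] at hT' hT''
          exact absurd (hT'.trans hT''.symm) hne
      have hTA : T ∉ 𝓐 := fun h => Finset.disjoint_left.1 (hfam.disjoint hm) h (by simp)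
      refine Or.inr ⟨𝓐 ∪ {T}, h1.union hfam, ?_, ?_⟩
      · rw [Finset.card_union_of_disjoint (hfam.disjoint hm), h2, Finset.card_singleton]
      · have h4 : ∑ v ∈ W, (min (coverage H 𝓐 v) t) + {v | v ∈ D ∧ Absorbs H T v}.ncard ≤
            ∑ v ∈ W, min (coverage H (𝓐 ∪ {T}) v) t := by
          have h5 : {v | v ∈ D ∧ Absorbs H T v}.ncard =
              ∑ v ∈ W, if v ∈ D ∧ Absorbs H T v then 1 else 0 := by
            rw [Finset.sum_boole, Set.ncard_eq_toFinset_card']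
            simp only [Nat.cast_id]
            congr 1
            ext v
            simp only [Set.mem_toFinset, Set.mem_ofPred_eq, Finset.mem_filter, hD]
            tauto
          rw [h5, ← Finset.sum_add_distrib]
          refine Finset.sum_le_sum fun v _ => ?_
          obtain ⟨h6, h7⟩ := coverage_union (H := H) hTA v
          split_ifs with hv
          · have h8 := h7 hv.2
            have h9 : coverage H 𝓐 v < t := (Finset.mem_filter.1 hv.1).2
            omega
          · omega
        have h4' : ((∑ v ∈ W, (min (coverage H 𝓐 v) t) : ℕ) : ℝ) +
            {v | v ∈ D ∧ Absorbs H T v}.ncard ≤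
            ((∑ v ∈ W, min (coverage H (𝓐 ∪ {T}) v) t : ℕ) : ℝ) := by exact_mod_cast h4
        refine le_trans ?_ h4'
        have h10 : (W.card : ℝ) ≤ 2 * D.card := by exact_mod_cast (by omega)
        push_cast
        push_cast at h3
        nlinarith

/-- The potential never exceeds `W.card * t`, so more than `2 * t / c` steps without success are
impossible. -/
theorem exists_family_half (hm : 1 ≤ m) (hH : HasAbsorbers H m c β) {W : Finset V}
    (hW : W.Nonempty) (hc : 0 < c) (hc1 : c ≤ 1) {t : ℕ} (ht : 1 ≤ t)
    (hs : (R.card : ℝ) + 2 * m * (3 * t / c) ≤ β * Fintype.card V) :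
    ∃ 𝓐, IsFamily H m R 𝓐 ∧ (𝓐.card : ℝ) ≤ 3 * t / c ∧
      ∃ W' ⊆ W, 2 * W'.card ≤ W.card ∧ ∀ v ∈ W \ W', t ≤ coverage H 𝓐 v := by
  set s : ℕ := ⌊2 * t / c⌋₊ + 1 with hs'
  have h1 : (s : ℝ) ≤ 3 * t / c := by
    have h2 : (⌊2 * t / c⌋₊ : ℝ) ≤ 2 * t / c := Nat.floor_le (by positivity)
    have h3 : (1 : ℝ) ≤ t / c := by
      rw [le_div_iff₀ hc]
      have : (1 : ℝ) ≤ t := by exact_mod_cast ht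
      linarith
    have h4 : (3 * t / c : ℝ) = 2 * t / c + t / c := by ring
    rw [hs', h4]
    push_cast
    linarith
  rcases exists_family_step hm hH (W := W) hc t s
    (le_trans (by gcongr) hs) with ⟨𝓐, h2, h3, h4⟩ | ⟨𝓐, h2, h3, h4⟩
  · exact ⟨𝓐, h2, le_trans (by exact_mod_cast h3) h1, h4⟩
  · exfalso
    have h5 : (2 * t / c : ℝ) < s := by
      rw [hs']
      push_cast
      exact Nat.lt_floor_add_one _
    have h6 : ((∑ v ∈ W, (min (coverage H 𝓐 v) t) : ℕ) : ℝ) ≤ W.card * t := by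
      have : ∑ v ∈ W, (min (coverage H 𝓐 v) t) ≤ W.card * t :=
        Finset.sum_le_card_nsmul _ _ _ fun v _ => min_le_right _ _
      exact_mod_cast this
    have h7 : (0 : ℝ) < W.card := by exact_mod_cast hW.card_pos
    rw [div_lt_iff₀ hc] at h5
    push_cast at h6 h4
    nlinarith

/-- The target is the size of the current set, so it halves with the set and the costs `3 * W.card /
c` sum to a geometric series. -/
theorem exists_family_small (hm : 1 ≤ m) (hH : HasAbsorbers H m c β) (hc : 0 < c) (hc1 : c ≤ 1)
    (W : Finset V) (R : Finset V)
    (hs : (R.card : ℝ) + 2 * m * (6 * W.card / c) ≤ β * Fintype.card V) :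
    ∃ 𝓐, IsFamily H m R 𝓐 ∧ (𝓐.card : ℝ) ≤ 6 * W.card / c ∧
      ∀ U ⊆ W, CanAbsorb H 𝓐 U := by
  induction hw : W.card using Nat.strong_induction_on generalizing W R with
  | _ w ih =>
  subst hw
  rcases W.eq_empty_or_nonempty with rfl | hW
  · refine ⟨∅, ⟨by simp, by simp⟩, by simp, fun U hU => ?_⟩
    rw [Finset.subset_empty] at hU
    subst hU
    exact ⟨fun _ => ([], []), by simp, by simp⟩
  have hWpos := hW.card_pos
  have h0 : (3 * W.card / c : ℝ) + 3 * W.card / c = 6 * W.card / c := by ring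
  have hpos : (0 : ℝ) ≤ 3 * W.card / c := by positivity
  have hm0 : (0 : ℝ) ≤ 2 * m := by positivity
  obtain ⟨𝓐, hA1, hA2, W', hW'1, hW'2, hA3⟩ := exists_family_half hm hH hW hc hc1 (t := W.card)
    (by omega) (le_trans (by nlinarith) hs)
  have h1 : (6 * W'.card / c : ℝ) ≤ 3 * W.card / c := by
    have : (2 * W'.card : ℝ) ≤ W.card := by exact_mod_cast hW'2
    rw [div_le_div_iff_of_pos_right hc]
    linarith
  have h2 : ((R ∪ familyVerts 𝓐).card : ℝ) ≤ R.card + 2 * m * (3 * W.card / c) := by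
    have h3 : ((R ∪ familyVerts 𝓐).card : ℝ) ≤ R.card + 2 * m * 𝓐.card := by
      exact_mod_cast (Finset.card_union_le R (familyVerts 𝓐)).trans
          (Nat.add_le_add_left hA1.card_verts_le _)
    nlinarith
  obtain ⟨𝓑, hB1, hB2, hB3⟩ := ih W'.card (by omega) W' (R ∪ familyVerts 𝓐)
    (by nlinarith) rfl
  have hdisj := hB1.disjoint hm
  refine ⟨𝓐 ∪ 𝓑, hA1.union hB1, ?_, fun U hU => ?_⟩
  · rw [Finset.card_union_of_disjoint hdisj]
    push_cast
    linarith
  · exact CanAbsorb.of_coverage hdisj (Finset.card_le_card hU)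
      (fun v hv => hA3 v (Finset.sdiff_subset_sdiff hU le_rfl hv)) (hB3 _ Finset.inter_subset_right)

/-- With target `t` each halving costs `3 * t / c`; after `J` of them at most `t` vertices are left
for `exists_family_small`. The price of treating a large set is thus only a factor logarithmic in
its size over `t`. -/
theorem exists_family (hm : 1 ≤ m) (hH : HasAbsorbers H m c β) (hc : 0 < c) (hc1 : c ≤ 1)
    {t : ℕ} (ht : 1 ≤ t) (J : ℕ) (W : Finset V) (hW : W.card ≤ 2 ^ J * t) (R : Finset V)
    (hs : (R.card : ℝ) + 2 * m * ((6 + 3 * J) * t / c) ≤ β * Fintype.card V) :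
    ∃ 𝓐, IsFamily H m R 𝓐 ∧ (𝓐.card : ℝ) ≤ (6 + 3 * J) * t / c ∧
      ∀ U ⊆ W, U.card ≤ t → CanAbsorb H 𝓐 U := by
  have hm0 : (0 : ℝ) ≤ 2 * m := by positivity
  induction J generalizing W R with
  | zero =>
    have hW' : (6 * W.card / c : ℝ) ≤ (6 + 3 * (0 : ℕ)) * t / c := by
      rw [div_le_div_iff_of_pos_right hc]
      have : (W.card : ℝ) ≤ t := by exact_mod_cast (by simpa using hW)
      push_cast
      linarith
    obtain ⟨𝓐, h1, h2, h3⟩ := exists_family_small hm hH hc hc1 W R (le_trans (by nlinarith) hs)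
    exact ⟨𝓐, h1, h2.trans hW', fun U hU _ => h3 U hU⟩
  | succ J ih =>
    rcases W.eq_empty_or_nonempty with rfl | hWne
    · refine ⟨∅, ⟨by simp, by simp⟩, ?_, fun U hU _ => ?_⟩
      · simp only [Finset.card_empty, Nat.cast_zero]
        positivity
      · rw [Finset.subset_empty] at hU
        subst hU
        exact ⟨fun _ => ([], []), by simp, by simp⟩
    have h0 : ((6 + 3 * (J + 1 : ℕ)) * t / c : ℝ) = 3 * t / c + (6 + 3 * J) * t / c := by
      push_cast; ring
    have hpos : (0 : ℝ) ≤ (6 + 3 * J) * t / c := by positivity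
    rw [h0] at hs ⊢
    obtain ⟨𝓐, hA1, hA2, W', hW'1, hW'2, hA3⟩ := exists_family_half hm hH hWne hc hc1 ht
      (le_trans (by nlinarith) hs)
    have h2 : ((R ∪ familyVerts 𝓐).card : ℝ) ≤ R.card + 2 * m * (3 * t / c) := by
      have h3 : ((R ∪ familyVerts 𝓐).card : ℝ) ≤ R.card + 2 * m * 𝓐.card := by
        exact_mod_cast (Finset.card_union_le R (familyVerts 𝓐)).trans
            (Nat.add_le_add_left hA1.card_verts_le _)
      nlinarith
    obtain ⟨𝓑, hB1, hB2, hB3⟩ := ih W' (by rw [pow_succ] at hW; nlinarith) (R ∪ familyVerts 𝓐)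
      (by nlinarith)
    have hdisj := hB1.disjoint hm
    refine ⟨𝓐 ∪ 𝓑, hA1.union hB1, ?_, fun U hU hUt => ?_⟩
    · rw [Finset.card_union_of_disjoint hdisj]
      push_cast
      linarith
    · exact CanAbsorb.of_coverage hdisj hUt
        (fun v hv => hA3 v (Finset.sdiff_subset_sdiff hU le_rfl hv))
        (hB3 _ Finset.inter_subset_right ((Finset.card_le_card Finset.inter_subset_left).trans hUt))

end Absorbers

/-! ### Stringing absorbers together -/

section Chains

variable {V : Type*}

/-- Concatenate the absorbers `T` and those listed in `L`, with `σ` put in the middle of each of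
them, and with the given connections between them. -/
def chain (σ : List V × List V → List V) (T : List V × List V)
    (L : List (List V × (List V × List V))) : List V :=
  T.1 ++ σ T ++ T.2 ++ L.flatMap fun e => e.1 ++ (e.2.1 ++ σ e.2 ++ e.2.2)

/-- The last half absorber of a chain. -/
def chainEnd : List V × List V → List (List V × (List V × List V)) → List V
  | T, [] => T.2
  | _, e :: L => chainEnd e.2 L

/-- The given connections join consecutive absorbers. -/
def IsLinked (H : SimpleGraph V) (m : ℕ) :
    List V × List V → List (List V × (List V × List V)) → Prop
  | _, [] => True
  | T, e :: L => PowWalk H.Adj m (T.2 ++ e.1 ++ e.2.1) ∧ IsLinked H m e.2 L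

theorem chain_cons (σ : List V × List V → List V) (T : List V × List V)
    (e : List V × (List V × List V)) (L : List (List V × (List V × List V))) :
    chain σ T (e :: L) = T.1 ++ σ T ++ T.2 ++ e.1 ++ chain σ e.2 L := by
  simp [chain]

theorem powWalk_chain {H : SimpleGraph V} {m : ℕ} {σ : List V × List V → List V}
    {T : List V × List V} {L : List (List V × (List V × List V))}
    (hT : ∀ T' ∈ T :: L.map Prod.snd, T'.1.length = m ∧ T'.2.length = m ∧
      PowWalk H.Adj m (T'.1 ++ σ T' ++ T'.2)) (hL : IsLinked H m T L) :
    PowWalk H.Adj m (chain σ T L) := by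
  induction L generalizing T with
  | nil => simpa [chain] using (hT T (by simp)).2.2
  | cons e L ih =>
    obtain ⟨h1, h2⟩ := hL
    have h3 := ih (T := e.2) (fun T' hT' => hT T' (by
      rw [List.map_cons]; exact List.mem_cons_of_mem _ hT')) h2
    obtain ⟨h4, h5, h6⟩ := hT T (by simp)
    obtain ⟨h7, -, -⟩ := hT e.2 (by simp)
    have h8 : PowWalk H.Adj m (T.1 ++ σ T ++ T.2 ++ (e.1 ++ e.2.1)) :=
      h6.glue (by simpa using h1) (by omega)
    have h9 : ∃ S, chain σ e.2 L = e.2.1 ++ S := ⟨_, by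
      rw [chain, List.append_assoc, List.append_assoc]⟩
    obtain ⟨S, hS⟩ := h9
    rw [hS] at h3
    have := PowWalk.glue (P := T.1 ++ σ T ++ T.2 ++ e.1) (Q := e.2.1) (S := S)
      (by simpa using h8) h3 (by omega)
    rw [chain_cons, hS]
    simpa using this

theorem chain_perm (σ : List V × List V → List V) (T : List V × List V)
    (L : List (List V × (List V × List V))) :
    (chain σ T L).Perm ((T :: L.map Prod.snd).flatMap (fun T => T.1 ++ T.2) ++
      L.flatMap Prod.fst ++ (T :: L.map Prod.snd).flatMap σ) := by
  induction L generalizing T with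
  | nil =>
    rw [← Multiset.coe_eq_coe]
    simp only [chain, List.flatMap_nil, List.append_nil, List.map_nil, List.flatMap_cons,
      ← Multiset.coe_add]
    abel
  | cons e L ih =>
    have ih := ih e.2
    rw [← Multiset.coe_eq_coe] at ih ⊢
    simp only [chain_cons, List.map_cons, List.flatMap_cons, ← Multiset.coe_add] at ih ⊢
    rw [ih]
    abel

theorem chain_eq_append_chainEnd (σ : List V × List V → List V) (T : List V × List V)
    (L : List (List V × (List V × List V))) : ∃ s, chain σ T L = s ++ chainEnd T L := by
  induction L generalizing T with
  | nil => exact ⟨T.1 ++ σ T, by simp [chain, chainEnd]⟩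
  | cons e L ih =>
    obtain ⟨s, hs⟩ := ih e.2
    exact ⟨T.1 ++ σ T ++ T.2 ++ e.1 ++ s, by rw [chain_cons, hs, chainEnd]; simp⟩

theorem length_chainEnd {m : ℕ} {T : List V × List V} {L : List (List V × (List V × List V))}
    (hT : ∀ T' ∈ T :: L.map Prod.snd, T'.2.length = m) : (chainEnd T L).length = m := by
  induction L generalizing T with
  | nil => exact hT T (by simp)
  | cons e L ih => exact ih fun T' hT' => hT T' (by
      rw [List.map_cons]; exact List.mem_cons_of_mem _ hT')

theorem firstEnd_chain {m : ℕ} (σ : List V × List V → List V) {T : List V × List V}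
    (L : List (List V × (List V × List V))) (hT : T.1.length = m) :
    firstEnd m (chain σ T L) = T.1 := by
  rw [firstEnd, chain, List.append_assoc, List.append_assoc, List.take_left' hT]

theorem lastEnd_chain {m : ℕ} (σ : List V × List V → List V) {T : List V × List V}
    {L : List (List V × (List V × List V))} (hT : ∀ T' ∈ T :: L.map Prod.snd, T'.2.length = m) :
    lastEnd m (chain σ T L) = chainEnd T L := by
  obtain ⟨s, hs⟩ := chain_eq_append_chainEnd σ T L
  have := length_chainEnd hT
  rw [lastEnd, hs]
  refine List.drop_left' ?_
  rw [List.length_append]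
  omega

theorem PowWalk.pairwise {α : Type*} {r : α → α → Prop} {m : ℕ} {l : List α}
    (h : PowWalk r m l) (hl : l.length ≤ m) : l.Pairwise r := by
  rw [List.pairwise_iff_getElem]
  intro i j hi hj hij
  exact h i j _ _ hij (by omega) (List.getElem?_eq_getElem hi) (List.getElem?_eq_getElem hj)

theorem PowWalk.isPowerPath {H : SimpleGraph V} {m : ℕ} {l : List V} (h : PowWalk H.Adj m l)
    (hn : l.Nodup) (hl : m ≤ l.length) : IsPowerPath H m l :=
  ⟨hn, hl, fun i j hi hj hij hjm =>
    h i j _ _ hij hjm (List.getElem?_eq_getElem hi) (List.getElem?_eq_getElem hj)⟩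

/-- `PowWalk.insert_block` is applied one power lower, since entries on different sides of `v` move
one step apart. -/
theorem PowWalk.insert_middle {H : SimpleGraph V} {m : ℕ} (hm : 1 ≤ m) {P Q : List V} {v : V}
    (h : PowWalk H.Adj m (P ++ Q)) (hP : P.length = m) (hv : ∀ u ∈ P ++ Q, H.Adj v u) :
    PowWalk H.Adj m (P ++ [v] ++ Q) := by
  obtain ⟨m, rfl⟩ : ∃ m', m = m' + 1 := ⟨m - 1, by omega⟩
  rw [List.append_assoc]
  refine PowWalk.insert_block (T := Q) hP.le rfl ?_ ?_ ?_
  · exact fun i j a b hij hjm ha hb => h i j a b hij (by omega) ha hb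
  · rw [powWalk_cons]
    exact ⟨fun b hb => hv b (List.mem_append_right _ (List.mem_of_mem_take hb)), h.right⟩
  · exact fun a ha => (hv a (List.mem_append_left _ ha)).symm

/-- The elements of `U` that are assigned to the absorber `T`. -/
noncomputable def assigned (φ : V → List V × List V) (U : Finset V) (T : List V × List V) :
    List V :=
  open Classical in if h : ∃ v ∈ U, φ v = T then [h.choose] else []

theorem assigned_eq (φ : V → List V × List V) (U : Finset V) (T : List V × List V) :
    ((∀ v ∈ U, φ v ≠ T) ∧ assigned φ U T = []) ∨ ∃ v ∈ U, φ v = T ∧ assigned φ U T = [v] := by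
  by_cases h : ∃ v ∈ U, φ v = T
  · right
    exact ⟨h.choose, h.choose_spec.1, h.choose_spec.2, by rw [assigned, dif_pos h]⟩
  · left
    refine ⟨fun v hv hvT => h ⟨v, hv, hvT⟩, by rw [assigned, dif_neg h]⟩

theorem mem_assigned {φ : V → List V × List V} {U : Finset V} (hφ : Set.InjOn φ U)
    {T : List V × List V} {v : V} : v ∈ assigned φ U T ↔ v ∈ U ∧ φ v = T := by
  rcases assigned_eq φ U T with ⟨h1, h2⟩ | ⟨w, hw, hwT, h2⟩
  · rw [h2]
    simpa using h1 v
  · rw [h2, List.mem_singleton]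
    constructor
    · rintro rfl
      exact ⟨hw, hwT⟩
    · rintro ⟨hv, hvT⟩
      exact hφ hv hw (hvT.trans hwT.symm)

variable [Fintype V] [DecidableEq V]

/-- Outside any small set any two cliques of size `m` can be joined by `ℓ` inner vertices. -/
def HasConnections (H : SimpleGraph V) (m ℓ : ℕ) (β : ℝ) : Prop :=
  ∀ R : Finset V, (R.card : ℝ) ≤ β * Fintype.card V → ∀ x z : List V, x.length = m →
    z.length = m → x.Pairwise H.Adj → z.Pairwise H.Adj →
    ∃ C : List V, C.length = ℓ ∧ C.Nodup ∧ (∀ a ∈ C, a ∉ R) ∧ PowWalk H.Adj m (x ++ C ++ z)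

theorem HasConnections.exists_isLinked {H : SimpleGraph V} {m ℓ : ℕ} {β : ℝ}
    (hH : HasConnections H m ℓ β) (L : List (List V × List V)) (T : List V × List V)
    (hT : ∀ T' ∈ T :: L, IsAbsorber H m T') (R : Finset V)
    (hR : (R.card : ℝ) + ℓ * L.length ≤ β * Fintype.card V) :
    ∃ L' : List (List V × (List V × List V)), L'.map Prod.snd = L ∧ IsLinked H m T L' ∧
      (L'.flatMap Prod.fst).Nodup ∧ (∀ a ∈ L'.flatMap Prod.fst, a ∉ R) ∧
      (L'.flatMap Prod.fst).length = ℓ * L.length := by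
  induction L generalizing T R with
  | nil => exact ⟨[], rfl, trivial, by simp, by simp, by simp⟩
  | cons T' L ih =>
    rw [List.length_cons] at hR
    push_cast at hR
    have hℓ : (0 : ℝ) ≤ ℓ := by positivity
    have hLl : (0 : ℝ) ≤ L.length := by positivity
    obtain ⟨-, h2, -, h3⟩ := hT T (by simp)
    obtain ⟨h4, -, -, h5⟩ := hT T' (by simp)
    obtain ⟨C, hC1, hC2, hC3, hC4⟩ := hH R (by nlinarith) T.2 T'.1 h2 h4
      (h3.right.pairwise h2.le) (h5.left.pairwise h4.le)
    have hcard : ((R ∪ C.toFinset).card : ℝ) ≤ R.card + ℓ := by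
      have := (Finset.card_union_le R C.toFinset).trans
        (Nat.add_le_add_left (List.toFinset_card_le C) _)
      rw [hC1] at this
      exact_mod_cast this
    obtain ⟨L', hL1, hL2, hL3, hL4, hL5⟩ := ih T'
      (fun S hS => hT S (List.mem_cons_of_mem _ hS)) (R ∪ C.toFinset) (by linarith)
    refine ⟨(C, T') :: L', by simp [hL1], ⟨hC4, hL2⟩, ?_, ?_, ?_⟩
    · rw [List.flatMap_cons, List.nodup_append]
      refine ⟨hC2, hL3, ?_⟩
      rintro a ha b hb rfl
      exact hL4 a hb (Finset.mem_union_right _ (List.mem_toFinset.2 ha))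
    · intro a ha
      rw [List.flatMap_cons, List.mem_append] at ha
      rcases ha with ha | ha
      · exact hC3 a ha
      · exact fun haR => hL4 a ha (Finset.mem_union_left _ haR)
    · rw [List.flatMap_cons, List.length_append, hL5, hC1, List.length_cons]
      ring

/-- Both paths are chains over the same absorbers and connections and differ only in the middles of
the absorbers, hence have the same ends. -/
theorem hasAbsorbingPaths_of_family {H : SimpleGraph V} {k ℓ : ℕ} {γ β : ℝ}
    (hH : HasConnections H (k + 1) ℓ β)
    (hfam : ∀ R : Finset V, (R.card : ℝ) ≤ γ ^ 2 * Fintype.card V → ∃ 𝓐 : Finset (List V × List V),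
      IsFamily H (k + 1) R 𝓐 ∧ 𝓐.Nonempty ∧
      (𝓐.card : ℝ) * (2 * (k + 1) + ℓ) ≤ γ * Fintype.card V / 2 ∧
      ∀ U : Finset V, (U.card : ℝ) ≤ 2 * γ ^ 2 * Fintype.card V → CanAbsorb H 𝓐 U)
    (hγ : γ ^ 2 + γ / 2 ≤ β) : HasAbsorbingPaths k γ H := by
  intro R hR
  obtain ⟨𝓐, h𝓐, hne, hcard, habs⟩ := hfam R hR
  obtain ⟨T, L, hTL⟩ : ∃ T L, 𝓐.toList = T :: L :=
    List.exists_cons_of_ne_nil (by simpa using hne.ne_empty)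
  have hmem : ∀ T', T' ∈ T :: L ↔ T' ∈ 𝓐 := fun T' => by rw [← hTL, Finset.mem_toList]
  have hlen : 𝓐.card = L.length + 1 := by
    rw [← Finset.length_toList, hTL, List.length_cons]
  have hnd : (T :: L).Nodup := hTL ▸ 𝓐.nodup_toList
  have habsb : ∀ T' ∈ T :: L, IsAbsorber H (k + 1) T' := fun T' hT' =>
    (h𝓐.1 T' ((hmem T').1 hT')).1
  have hn : (0 : ℝ) ≤ Fintype.card V := by positivity
  -- The connections avoid `R`, of size at most `γ² n`, and all absorbers and earlier connections,
  -- at most `γ n / 2` vertices in total.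
  obtain ⟨L', hL1, hL2, hL3, hL4, hL5⟩ := hH.exists_isLinked L T habsb (R ∪ familyVerts 𝓐) (by
    have h1 : ((R ∪ familyVerts 𝓐).card : ℝ) ≤ R.card + 2 * (k + 1) * 𝓐.card := by
      exact_mod_cast (Finset.card_union_le R (familyVerts 𝓐)).trans
        (Nat.add_le_add_left h𝓐.card_verts_le _)
    have h2 : (𝓐.card : ℝ) = L.length + 1 := by exact_mod_cast hlen
    have h3 : (γ ^ 2 + γ / 2) * Fintype.card V ≤ β * Fintype.card V := by gcongr
    have h4 : (0 : ℝ) ≤ ℓ := by positivity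
    rw [h2] at h1 hcard
    nlinarith)
  have hverts : ∀ a, a ∈ (T :: L).flatMap (fun T => T.1 ++ T.2) ↔ a ∈ familyVerts 𝓐 := by
    intro a
    rw [List.mem_flatMap, mem_familyVerts]
    simp only [hmem]
  have hvnd : ((T :: L).flatMap fun T => T.1 ++ T.2).Nodup := by
    rw [List.nodup_flatMap]
    refine ⟨fun T' hT' => (habsb T' hT').2.2.1, ?_⟩
    refine hnd.imp_of_mem fun {a b} ha hb hab => ?_
    exact h𝓐.2 a ((hmem a).1 ha) b ((hmem b).1 hb) hab
  have hbase : ((T :: L).flatMap (fun T => T.1 ++ T.2) ++ L'.flatMap Prod.fst).Nodup := by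
    rw [List.nodup_append]
    refine ⟨hvnd, hL3, ?_⟩
    rintro a ha b hb rfl
    exact hL4 a hb (Finset.mem_union_right _ ((hverts a).1 ha))
  have hperm : ∀ σ, (chain σ T L').Perm ((T :: L).flatMap (fun T => T.1 ++ T.2) ++
      L'.flatMap Prod.fst ++ (T :: L).flatMap σ) := by
    intro σ
    have := chain_perm σ T L'
    rwa [hL1] at this
  have hT1 : T.1.length = k + 1 := (habsb T (by simp)).1
  have hT2 : ∀ T' ∈ T :: L'.map Prod.snd, T'.2.length = k + 1 := by
    rw [hL1]
    exact fun T' hT' => (habsb T' hT').2.1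
  have hlb : ∀ σ, k + 1 ≤ (chain σ T L').length := by
    intro σ
    rw [chain, List.append_assoc, List.append_assoc, List.length_append]
    omega
  have hpermA : (chain (fun _ => []) T L').Perm ((T :: L).flatMap (fun T => T.1 ++ T.2) ++
      L'.flatMap Prod.fst) := by
    have h := hperm fun _ => []
    have hnil : ((T :: L).flatMap fun _ => ([] : List V)) = [] := by
      rw [List.flatMap_eq_nil_iff]; simp
    rwa [hnil, List.append_nil] at h
  refine ⟨chain (fun _ => []) T L', ?_, ?_, ?_, ?_⟩
  · refine (powWalk_chain ?_ hL2).isPowerPath (hpermA.nodup_iff.2 hbase) (hlb _)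
    rw [hL1]
    intro T' hT'
    obtain ⟨h1, h2, -, h3⟩ := habsb T' hT'
    exact ⟨h1, h2, by simpa using h3⟩
  · intro v hv
    rw [hpermA.mem_iff, List.mem_append] at hv
    rcases hv with hv | hv
    · obtain ⟨T', hT', hvT⟩ := List.mem_flatMap.1 hv
      exact (h𝓐.1 T' ((hmem T').1 hT')).2 v hvT
    · exact fun hvR => hL4 v hv (Finset.mem_union_left _ hvR)
  · have h1 : ((T :: L).flatMap fun T => T.1 ++ T.2).length = (2 * (k + 1)) * (L.length + 1) := by
      rw [List.length_flatMap, List.map_congr_left (g := fun _ => 2 * (k + 1)), List.map_const',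
        List.sum_replicate, List.length_cons, smul_eq_mul, mul_comm]
      intro T' hT'
      obtain ⟨h1, h2, -, -⟩ := habsb T' hT'
      rw [List.length_append, h1, h2, two_mul]
    rw [hpermA.length_eq, List.length_append, h1, hL5]
    refine le_trans ?_ hcard
    rw [hlen]
    push_cast
    have h4 : (0 : ℝ) ≤ ℓ := by positivity
    nlinarith
  · intro U hU
    set A := chain (fun _ => []) T L' with hA
    -- Vertices of `U` that already lie on `A` must not be inserted again.
    set U' := U.filter fun v => v ∉ A with hU'
    obtain ⟨φ, hφ1, hφ2⟩ := habs U' (le_trans (by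
      exact_mod_cast Finset.card_le_card (Finset.filter_subset _ _)) hU)
    have hmid : ∀ a, a ∈ (T :: L).flatMap (assigned φ U') ↔ a ∈ U' := by
      intro a
      rw [List.mem_flatMap]
      constructor
      · rintro ⟨T', -, ha⟩
        exact ((mem_assigned hφ1).1 ha).1
      · intro ha
        exact ⟨φ a, (hmem _).2 (hφ2 a ha).1, (mem_assigned hφ1).2 ⟨ha, rfl⟩⟩
    have hmidnd : ((T :: L).flatMap (assigned φ U')).Nodup := by
      rw [List.nodup_flatMap]
      refine ⟨fun T' _ => ?_, hnd.imp fun {a b} hab => ?_⟩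
      · rcases assigned_eq φ U' T' with ⟨-, h⟩ | ⟨v, -, -, h⟩ <;> simp [h]
      · intro v hv hv'
        exact hab (((mem_assigned hφ1).1 hv).2.symm.trans ((mem_assigned hφ1).1 hv').2)
    refine ⟨chain (assigned φ U') T L', ?_, ?_, ?_, ?_⟩
    · refine (powWalk_chain ?_ hL2).isPowerPath ((hperm _).nodup_iff.2 ?_) (hlb _)
      · rw [hL1]
        intro T' hT'
        obtain ⟨h1, h2, -, h3⟩ := habsb T' hT'
        refine ⟨h1, h2, ?_⟩
        rcases assigned_eq φ U' T' with ⟨-, h⟩ | ⟨v, hv, hvT, h⟩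
        · simpa [h] using h3
        · rw [h]
          refine h3.insert_middle (by omega) h1 ?_
          have := (hφ2 v hv).2
          rwa [hvT] at this
      · rw [List.nodup_append]
        refine ⟨hbase, hmidnd, ?_⟩
        rintro a ha b hb rfl
        exact (Finset.mem_filter.1 ((hmid a).1 hb)).2 (hpermA.mem_iff.2 ha)
    · intro v
      rw [(hperm _).mem_iff, List.mem_append, hmid, ← hpermA.mem_iff]
      simp only [hU', Finset.mem_filter, hA]
      tauto
    · rw [firstEnd_chain _ _ hT1, firstEnd_chain _ _ hT1]
    · rw [lastEnd_chain _ hT2, lastEnd_chain _ hT2]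

end Chains

/-! ### Common neighbours from the minimum degree -/

section Degree

variable {V : Type*} [Fintype V]

theorem ncard_add_ncard_le_inter (A B : Set V) :
    A.ncard + B.ncard ≤ (A ∩ B).ncard + Fintype.card V := by
  rw [← Set.ncard_union_add_ncard_inter A B, add_comm]
  exact Nat.add_le_add_left (ncard_le_fintype_card _) _

/-- Each vertex excludes at most `δ` vertices, and `(k + 1) * δ = n - (k + 1) * ε * n`. -/
theorem hasCommonNbrs_of_degree {G : SimpleGraph V} {k : ℕ} {ε : ℝ} (hε : 0 ≤ ε)
    (hG : ∀ v, ((k : ℝ) / (k + 1) + ε) * Fintype.card V ≤ {w | G.Adj v w}.ncard) :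
    HasCommonNbrs G Set.univ Set.univ (k + 1) (ε * Fintype.card V) := by
  set n : ℝ := ((Fintype.card V : ℕ) : ℝ) with hn
  have hn0 : 0 ≤ n := by positivity
  set δ : ℝ := n - ((k : ℝ) / (k + 1) + ε) * n with hδ
  have hδ0 : 0 ≤ δ := by
    rcases isEmpty_or_nonempty V with h | ⟨⟨v⟩⟩
    · have : n = 0 := by simp [hn]
      rw [hδ, this]; simp
    · have h1 : ({w | G.Adj v w}.ncard : ℝ) ≤ n := by
        rw [hn]; exact Nat.cast_le.2 (ncard_le_fintype_card _)
      have := hG v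
      linarith
  have key : ∀ l : List V, n - l.length * δ ≤ ({w | ∀ a ∈ l, G.Adj a w}.ncard : ℝ) := by
    intro l
    induction l with
    | nil => simp [hn, Set.ncard_univ]
    | cons b l ih =>
      have h1 := ncard_add_ncard_le_inter {w | G.Adj b w} {w | ∀ a ∈ l, G.Adj a w}
      have h2 : {w | ∀ a ∈ b :: l, G.Adj a w} =
          {w | G.Adj b w} ∩ {w | ∀ a ∈ l, G.Adj a w} := by
        ext w; simp
      have h3 : ({w | G.Adj b w}.ncard : ℝ) + {w | ∀ a ∈ l, G.Adj a w}.ncard ≤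
          ({w | ∀ a ∈ b :: l, G.Adj a w}.ncard : ℝ) + n := by
        rw [h2, hn]; norm_cast
      have h4 := hG b
      rw [List.length_cons]
      push_cast
      linarith
  intro l hl _
  have h1 := key l
  have h2 : {w | w ∈ Set.univ ∧ ∀ a ∈ l, G.Adj a w} = {w | ∀ a ∈ l, G.Adj a w} := by
    ext w; simp
  rw [h2]
  refine le_trans ?_ h1
  have h3 : (l.length : ℝ) * δ ≤ (k + 1) * δ := by
    refine mul_le_mul_of_nonneg_right ?_ hδ0
    exact_mod_cast hl
  have h4 : (k + 1) * δ = n - (k + 1) * ε * n := by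
    rw [hδ]; field_simp; ring
  have h5 : 0 ≤ (k : ℝ) * (ε * n) := by positivity
  nlinarith

theorem HasCommonNbrs.mono {G G' : SimpleGraph V} {X Y : Set V} {m : ℕ} {β β' : ℝ}
    (h : HasCommonNbrs G X Y m β) (hG : G ≤ G') (hβ : β' ≤ β) : HasCommonNbrs G' X Y m β' := by
  intro l hl hY
  refine hβ.trans ((h l hl hY).trans ?_)
  rw [Nat.cast_le]
  exact Set.ncard_le_ncard fun w hw => ⟨hw.1, fun a ha => hG (hw.2 a ha)⟩

theorem HasCommonNbrs.compl {G : SimpleGraph V} {m : ℕ} {β β' : ℝ} {R : Finset V}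
    (h : HasCommonNbrs G Set.univ Set.univ m β) (hR : R.card + β' ≤ β) :
    HasCommonNbrs G (R : Set V)ᶜ Set.univ m β' := by
  intro l hl hY
  have h1 := h l hl hY
  have h2 : {w | w ∈ Set.univ ∧ ∀ a ∈ l, G.Adj a w}.ncard ≤
      {w | w ∈ (R : Set V)ᶜ ∧ ∀ a ∈ l, G.Adj a w}.ncard + R.card := by
    rw [← Set.ncard_coe_finset R]
    refine (Set.ncard_le_ncard ?_).trans (Set.ncard_union_le _ _)
    intro w hw
    by_cases hwR : w ∈ (R : Set V)
    · exact Or.inr hwR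
    · exact Or.inl ⟨hwR, hw.2⟩
  have h2' : ({w | w ∈ Set.univ ∧ ∀ a ∈ l, G.Adj a w}.ncard : ℝ) ≤
      {w | w ∈ (R : Set V)ᶜ ∧ ∀ a ∈ l, G.Adj a w}.ncard + R.card := by exact_mod_cast h2
  linarith

end Degree

/-! ### Connections in the union with the random graph -/

section ConnectionFamilies

variable {V : Type} [Fintype V] {ι : Type}

/-- The complete graph on the vertices in a tuple. -/
def cliqueOn {V : Type*} {m : ℕ} (x : Fin m → V) : SimpleGraph V :=
  SimpleGraph.fromRel fun a b => a ∈ List.ofFn x ∧ b ∈ List.ofFn x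

/-- The choices of inner vertices outside `R` that join the cliques `x` and `z`, up to the pairs
in `M`. -/
def connectionFamily (G : SimpleGraph V) (m : ℕ) (π : List ι) (M : List (ι × ι))
    (i : Finset V × (Fin m → V) × (Fin m → V)) : Set (ι → V) :=
  {f | (∀ a, f a ∈ (i.1 : Set V)ᶜ) ∧
    PowWalk (LinkRel (G ⊔ (cliqueOn i.2.1 ⊔ cliqueOn i.2.2)) M) m
      (plain (List.ofFn i.2.1) ++ labelled f π ++ plain (List.ofFn i.2.2))}

theorem exists_ofFn_eq {α : Type*} {m : ℕ} {x : List α} (hx : x.length = m) :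
    ∃ f : Fin m → α, List.ofFn f = x :=
  ⟨fun i => x.get (i.cast hx.symm), by apply List.ext_getElem <;> simp [hx]⟩

theorem cliqueOn_le {V : Type*} {m : ℕ} {x : Fin m → V} {H : SimpleGraph V}
    (hx : (List.ofFn x).Pairwise H.Adj) : cliqueOn x ≤ H := by
  have : Std.Symm H.Adj := ⟨fun _ _ h => h.symm⟩
  intro a b hab
  rw [cliqueOn, SimpleGraph.fromRel_adj] at hab
  obtain ⟨hne, ⟨ha, hb⟩ | ⟨hb, ha⟩⟩ := hab
  all_goals exact hx.forall ha hb hne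

theorem pairwise_cliqueOn {V : Type*} {m : ℕ} {x : Fin m → V} {H : SimpleGraph V}
    (hx : (List.ofFn x).Pairwise H.Adj) : (List.ofFn x).Pairwise (cliqueOn x).Adj := by
  refine hx.imp_of_mem fun {a b} ha hb hab => ?_
  rw [cliqueOn, SimpleGraph.fromRel_adj]
  exact ⟨hab.ne, Or.inl ⟨ha, hb⟩⟩

/-- The end cliques may use random edges. Adding them to `G` by `cliqueOn` makes the family of
placements depend on `G`, `R`, `x`, `z` and not on `F`, as the union bound requires. -/
theorem hasConnections_of_event {k : ℕ} {π : List ι} {M : List (ι × ι)} {α c : ℝ} [Fintype ι]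
    [DecidableEq ι] (hπ : π.Nodup) {G F : SimpleGraph V}
    (hι : ∀ (G : SimpleGraph V) (X Y : Set V), X ⊆ Y →
        HasCommonNbrs G X Y (k + 1) (α * Fintype.card V) →
        ∀ x z : List V, x.length = k + 1 → z.length = k + 1 → (∀ a ∈ x, a ∈ Y) →
          (∀ a ∈ z, a ∈ Y) → x.Pairwise G.Adj → z.Pairwise G.Adj →
          c * (Fintype.card V : ℝ) ^ Fintype.card ι ≤
            {f : ι → V | (∀ i, f i ∈ X) ∧ PowWalk (LinkRel G M) (k + 1)
              (plain x ++ labelled f π ++ plain z)}.ncard)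
    (hG : HasCommonNbrs G Set.univ Set.univ (k + 1) (2 * α * Fintype.card V))
    (hF : ∀ i, c * (Fintype.card V : ℝ) ^ Fintype.card ι ≤
        (connectionFamily G (k + 1) π M i).ncard →
      ∃ f ∈ connectionFamily G (k + 1) π M i, Function.Injective f ∧
        ∀ e ∈ M, F.Adj (f e.1) (f e.2)) :
    HasConnections (G ⊔ F) (k + 1) π.length α := by
  intro R hR x z hx hz hxH hzH
  obtain ⟨x, rfl⟩ := exists_ofFn_eq hx
  obtain ⟨z, rfl⟩ := exists_ofFn_eq hz
  set G' := G ⊔ (cliqueOn x ⊔ cliqueOn z) with hG'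
  have hle : G' ≤ G ⊔ F := sup_le le_sup_left (sup_le (cliqueOn_le hxH) (cliqueOn_le hzH))
  obtain ⟨f, ⟨hf1, hf2⟩, hf3, hf4⟩ := hF (R, x, z) (hι G' (R : Set V)ᶜ Set.univ
    (Set.subset_univ _) ((hG.compl (by linarith)).mono le_sup_left le_rfl) _ _ hx hz (by simp)
    (by simp) ((pairwise_cliqueOn hxH).imp fun {a b} h => Or.inr (Or.inl h))
    ((pairwise_cliqueOn hzH).imp fun {a b} h => Or.inr (Or.inr h)))
  refine ⟨π.map f, by simp, hπ.map hf3, ?_, ?_⟩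
  · intro a ha
    obtain ⟨i, -, rfl⟩ := List.mem_map.1 ha
    simpa using hf1 i
  · refine hf2.of_forall₂ (R := fun p a => a = p.1 ∧ ∀ i, p.2 = some i → a = f i) ?_ ?_
    · refine List.rel_append (List.rel_append ?_ ?_) ?_
      · rw [plain, List.forall₂_map_left_iff]
        exact List.forall₂_same.2 fun _ _ => by simp
      · rw [labelled, List.forall₂_map_left_iff, List.forall₂_map_right_iff]
        exact List.forall₂_same.2 fun _ _ => by simp
      · rw [plain, List.forall₂_map_left_iff]
        exact List.forall₂_same.2 fun _ _ => by simp
    · rintro p q a b ⟨ha, ha'⟩ ⟨hb, hb'⟩ (h | ⟨e, he, ⟨h1, h2⟩ | ⟨h1, h2⟩⟩)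
      · rw [ha, hb]
        exact hle h
      · rw [ha' _ h1, hb' _ h2]
        exact Or.inr (hf4 e he)
      · rw [ha' _ h1, hb' _ h2]
        exact Or.inr (hf4 e he).symm

end ConnectionFamilies

/-! ### Absorbers in the union with the random graph -/

section AbsorberFamilies

variable {V : Type*} [Fintype V]

/-- The pairs at distance `m` in a sequence of length `2 m`. -/
def halfMatching (m : ℕ) : List (Fin (m + m) × Fin (m + m)) :=
  List.ofFn fun i : Fin m => (Fin.castAdd m i, Fin.natAdd m i)

theorem isMatchingList_halfMatching (m : ℕ) : IsMatchingList (halfMatching m) := by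
  constructor
  · intro e he
    obtain ⟨i, rfl⟩ := (List.mem_ofFn' _ _).1 he
    simp only [ne_eq, Fin.ext_iff, Fin.val_castAdd, Fin.val_natAdd]
    omega
  · rw [halfMatching, List.pairwise_ofFn]
    intro a b hab
    have := Fin.lt_def.1 hab
    simp only [ne_eq, Fin.ext_iff, Fin.val_castAdd, Fin.val_natAdd]
    omega

/-- The `k`-paths outside `R` that lie in the neighbourhood of a proportion `c` of the set `W`. -/
def absorberFamily (G : SimpleGraph V) (k : ℕ) (c : ℝ) (i : Finset V × Finset V) :
    Set (Fin (k + 1 + (k + 1)) → V) :=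
  {t | (∀ a, t a ∉ i.1) ∧ PowWalk G.Adj k (List.ofFn t) ∧
    c * i.2.card ≤ {v | v ∈ i.2 ∧ ∀ a, G.Adj v (t a)}.ncard}

theorem powWalk_concat {α : Type*} {r : α → α → Prop} {m : ℕ} {l : List α} {a : α}
    (h : PowWalk r m l) (ha : ∀ b ∈ l.drop (l.length - m), r b a) : PowWalk r m (l ++ [a]) := by
  intro i j b c hij hjm hb hc
  rcases lt_or_ge j l.length with hj | hj
  · rw [List.getElem?_append_left (by omega)] at hb hc
    exact h i j b c hij hjm hb hc
  · rw [List.getElem?_append_right hj] at hc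
    obtain ⟨h1, rfl⟩ := List.getElem?_eq_some_iff.1 hc
    simp only [List.length_singleton] at h1
    rw [List.getElem?_append_left (by omega)] at hb
    simp only [List.getElem_singleton]
    refine ha b (List.mem_iff_getElem?.2 ⟨i - (l.length - m), ?_⟩)
    rw [List.getElem?_drop, ← hb]
    congr 1
    omega

/-- A new vertex has `k + 1` prescribed neighbours, namely `v` and the last `k` entries. -/
theorem le_ncard_path_in_nbhd {G : SimpleGraph V} {k : ℕ} {β : ℝ} {R : Finset V} (hβ : 0 ≤ β)
    (hG : HasCommonNbrs G (R : Set V)ᶜ Set.univ (k + 1) β) (v : V) (N : ℕ) :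
    β ^ N ≤ {t : Fin N → V | (∀ a ∈ List.ofFn t, a ∉ R ∧ G.Adj v a) ∧
      PowWalk G.Adj k (List.ofFn t)}.ncard := by
  refine le_ncard_greedy hβ (fun l => (∀ a ∈ l, a ∉ R ∧ G.Adj v a) ∧ PowWalk G.Adj k l) N
    ⟨by simp, powWalk_nil⟩ fun l _ hl => ?_
  refine (hG (v :: l.drop (l.length - k)) (by simp; omega) (by simp)).trans ?_
  rw [Nat.cast_le]
  refine Set.ncard_le_ncard fun a ha => ⟨fun b hb => ?_,
    powWalk_concat hl.2 fun b hb => ha.2 b (List.mem_cons_of_mem _ hb)⟩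
  rcases List.mem_append.1 hb with hb | hb
  · exact hl.1 b hb
  · rw [List.mem_singleton] at hb
    subst hb
    exact ⟨by simpa using ha.1, ha.2 v (by simp)⟩

/-- Double counting of pairs of a vertex of `W` and a `k`-path in its neighbourhood: many paths are
good for at least half the average proportion of `W`. -/
theorem le_ncard_absorberFamily {G : SimpleGraph V} {k : ℕ} {α : ℝ} (hα : 0 < α)
    {R W : Finset V} (hW : W.Nonempty)
    (hG : HasCommonNbrs G (R : Set V)ᶜ Set.univ (k + 1) (α * Fintype.card V)) :
    α ^ (k + 1 + (k + 1)) / 2 * (Fintype.card V : ℝ) ^ (k + 1 + (k + 1)) ≤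
      (absorberFamily G k (α ^ (k + 1 + (k + 1)) / 2) (R, W)).ncard := by
  classical
  set N := k + 1 + (k + 1) with hN
  have : Nonempty W := hW.to_subtype
  set S : Set (W × (Fin N → V)) := {x | (∀ a ∈ List.ofFn x.2, a ∉ R ∧ G.Adj x.1 a) ∧
    PowWalk G.Adj k (List.ofFn x.2)} with hS
  have h1 := mul_le_ncard_of_fiber (S := S) (T := Set.univ) (c₁ := W.card)
    (c₂ := (α * Fintype.card V) ^ N) (by positivity) (by simp [Set.ncard_univ])
    fun v _ => le_ncard_path_in_nbhd (by positivity) hG (v : V) N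
  have h2 := le_ncard_rich_fiber (S := (Prod.swap ⁻¹' S : Set ((Fin N → V) × W)))
    (c := α ^ N) (by positivity) (by
      rw [ncard_preimage_swap]
      refine le_trans (le_of_eq ?_) h1
      simp only [Fintype.card_fun, Fintype.card_fin, Fintype.card_coe]
      push_cast
      rw [mul_pow]
      ring)
  simp only [Fintype.card_fun, Fintype.card_fin, Fintype.card_coe] at h2
  push_cast at h2
  refine h2.trans ?_
  rw [Nat.cast_le]
  refine Set.ncard_le_ncard fun t ht => ?_
  have ht : α ^ N / 2 * (W.card : ℝ) ≤ ({v : W | (v, t) ∈ S}.ncard : ℝ) := ht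
  have hpos : (0 : ℝ) < W.card := by exact_mod_cast hW.card_pos
  have hne : 0 < {v : W | (v, t) ∈ S}.ncard := by
    have : (0 : ℝ) < ({v : W | (v, t) ∈ S}.ncard : ℝ) := lt_of_lt_of_le (by positivity) ht
    exact_mod_cast this
  obtain ⟨v, hv⟩ := (Set.ncard_pos).1 hne
  have hmem : ∀ a, t a ∈ List.ofFn t := fun a => (List.mem_ofFn' _ _).2 ⟨a, rfl⟩
  refine ⟨fun a => (hv.1 _ (hmem a)).1, hv.2, ht.trans ?_⟩
  rw [Nat.cast_le]
  refine Set.ncard_le_ncard_of_injOn Subtype.val ?_ Subtype.val_injective.injOn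
  exact fun w hw => ⟨w.2, fun a => (hw.1 _ (hmem a)).2⟩

theorem hasAbsorbers_of_event {k : ℕ} {α : ℝ} (hα : 0 < α) {G F : SimpleGraph V} [DecidableEq V]
    (hG : HasCommonNbrs G Set.univ Set.univ (k + 1) (2 * α * Fintype.card V))
    (hF : ∀ i, α ^ (k + 1 + (k + 1)) / 2 *
        (Fintype.card V : ℝ) ^ Fintype.card (Fin (k + 1 + (k + 1))) ≤
        (absorberFamily G k (α ^ (k + 1 + (k + 1)) / 2) i).ncard →
      ∃ f ∈ absorberFamily G k (α ^ (k + 1 + (k + 1)) / 2) i, Function.Injective f ∧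
        ∀ e ∈ halfMatching (k + 1), F.Adj (f e.1) (f e.2)) :
    HasAbsorbers (G ⊔ F) (k + 1) (α ^ (k + 1 + (k + 1)) / 2) α := by
  intro R hR W hW
  obtain ⟨t, ⟨ht1, ht2, ht3⟩, ht4, ht5⟩ := hF (R, W) (by
    rw [Fintype.card_fin]
    exact le_ncard_absorberFamily hα hW (hG.compl (by linarith)))
  have happ : (List.ofFn t).take (k + 1) ++ (List.ofFn t).drop (k + 1) = List.ofFn t :=
    List.take_append_drop _ _
  refine ⟨((List.ofFn t).take (k + 1), (List.ofFn t).drop (k + 1)),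
    ⟨by simp, by simp, ?_, ?_⟩, ?_, ?_⟩
  · simp only [happ]
    exact List.nodup_ofFn.2 ht4
  · simp only [happ]
    intro i j a b hij hjm ha hb
    by_cases hj : j ≤ i + k
    · exact Or.inl (ht2 i j a b hij hj ha hb)
    · obtain ⟨hi', rfl⟩ := List.getElem?_eq_some_iff.1 ha
      obtain ⟨hj', rfl⟩ := List.getElem?_eq_some_iff.1 hb
      -- Pairs at distance exactly `k + 1` in `2 * (k + 1)` entries are those of `halfMatching`,
      -- supplied by `F`.
      have hji : j = k + 1 + i := by omega
      subst hji
      rw [List.length_ofFn] at hi' hj'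
      have := ht5 _ ((List.mem_ofFn' _ _).2 ⟨⟨i, by omega⟩, rfl⟩)
      right
      rw [List.getElem_ofFn, List.getElem_ofFn]
      exact this
  · intro a ha
    simp only [happ] at ha
    obtain ⟨i, rfl⟩ := (List.mem_ofFn' _ _).1 ha
    exact ht1 i
  · refine ht3.trans ?_
    rw [Nat.cast_le]
    refine Set.ncard_le_ncard fun v hv => ⟨hv.1, ?_⟩
    intro u hu
    simp only [happ] at hu
    obtain ⟨i, rfl⟩ := (List.mem_ofFn' _ _).1 hu
    exact Or.inl (hv.2 i)

end AbsorberFamilies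

/-! ### Choice of the parameters -/

theorem hasAbsorbingPaths_of_absorbers_of_connections {V : Type*} [Fintype V] [DecidableEq V]
    {H : SimpleGraph V} {k ℓ g : ℕ} {c α : ℝ} (hc : 0 < c) (hc1 : c ≤ 1)
    (hA : HasAbsorbers H (k + 1) c α) (hC : HasConnections H (k + 1) ℓ α)
    (hg1 : (1 / 2 : ℝ) ^ g ≤ 1 / 2) (hgα : (1 / 2 : ℝ) ^ g ≤ α)
    (hg : (6 + 6 * g) * (4 * (2 * (k + 1) + ℓ) / c) * (1 / 2 : ℝ) ^ g ≤ 1)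
    (hn : 1 ≤ ((1 / 2 : ℝ) ^ g) ^ 2 * Fintype.card V) :
    HasAbsorbingPaths k ((1 / 2 : ℝ) ^ g) H := by
  set γ : ℝ := (1 / 2 : ℝ) ^ g with hγ
  have hγ0 : 0 < γ := by positivity
  set n : ℝ := ((Fintype.card V : ℕ) : ℝ) with hn'
  have hn0 : 0 < n := by
    by_contra h
    nlinarith [sq_nonneg γ]
  have hβ : γ ^ 2 + γ / 2 ≤ α := by nlinarith
  -- The largest number of vertices to be absorbed; since `γ² n` is at least one, rounding still
  -- leaves `t` at least `γ² n`.
  set t : ℕ := ⌊2 * γ ^ 2 * n⌋₊ with ht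
  have ht1 : (t : ℝ) ≤ 2 * γ ^ 2 * n := Nat.floor_le (by positivity)
  have ht2 : γ ^ 2 * n ≤ t := by
    have := Nat.lt_floor_add_one (2 * γ ^ 2 * n)
    rw [← ht] at this
    linarith
  have ht3 : 1 ≤ t := by
    have : (1 : ℝ) ≤ t := hn.trans ht2
    exact_mod_cast this
  have hsize : ((6 + 3 * (2 * g : ℕ)) * t / c : ℝ) * (2 * (k + 1) + ℓ) ≤ γ * n / 2 := by
    have h1 : (6 + 6 * g) * (4 * (2 * (k + 1) + ℓ) / c) * γ * (γ * n / 2) ≤ γ * n / 2 := by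
      have : 0 ≤ γ * n / 2 := by positivity
      nlinarith
    refine le_trans ?_ h1
    have h2 : (6 + 6 * g) * (4 * (2 * (k + 1) + ℓ) / c) * γ * (γ * n / 2) =
        ((6 + 6 * g) * (2 * γ ^ 2 * n) / c) * (2 * (k + 1) + ℓ) := by
      field_simp
      ring
    rw [h2]
    push_cast
    have h3 : (6 + 3 * (2 * (g : ℝ))) = 6 + 6 * g := by ring
    rw [h3]
    gcongr
  refine hasAbsorbingPaths_of_family hC (fun R hR => ?_) hβ
  -- As `2 ^ (2 * g) * γ ^ 2 = 1`, halving `2 * g` times brings all `n` vertices down to at most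
  -- `t`.
  obtain ⟨𝓐, h1, h2, h3⟩ := exists_family (Nat.le_add_left 1 k) hA hc hc1 ht3 (2 * g)
    (Finset.univ : Finset V) (by
      have h4 : (2 : ℝ) ^ (2 * g) * γ ^ 2 = 1 := by
        rw [hγ, ← pow_mul, mul_comm g 2, ← mul_pow]
        norm_num
      have h5 : (Fintype.card V : ℝ) ≤ 2 ^ (2 * g) * t := by
        calc (Fintype.card V : ℝ) = 2 ^ (2 * g) * (γ ^ 2 * n) := by
              rw [← mul_assoc, h4, one_mul]
          _ ≤ 2 ^ (2 * g) * t := by gcongr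
      rw [Finset.card_univ]
      exact_mod_cast h5) R (by
      have hx : (0 : ℝ) ≤ (6 + 3 * (2 * g : ℕ)) * t / c := by positivity
      have hl : (0 : ℝ) ≤ ℓ := by positivity
      have h6 := mul_le_mul_of_nonneg_right hβ hn0.le
      push_cast at hsize hx ⊢
      nlinarith)
  have hpos : 0 < Fintype.card V := Nat.cast_pos.1 hn0
  refine ⟨𝓐, h1, ?_, ?_, fun U hU => h3 U (Finset.subset_univ _) (Nat.le_floor hU)⟩
  · obtain ⟨v⟩ := Fintype.card_pos_iff.1 hpos
    obtain ⟨φ, -, hφ⟩ := h3 {v} (Finset.subset_univ _) (by simpa using ht3)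
    exact ⟨φ v, (hφ v (by simp)).1⟩
  · refine le_trans ?_ hsize
    gcongr

/-- The number of halvings is linear in `g`, and `g / 2 ^ g` tends to zero: one spare factor `γ`
absorbs the logarithm. -/
theorem exists_small_exponent (D δ : ℝ) (hδ : 0 < δ) :
    ∃ g : ℕ, (6 + 6 * g) * D * (1 / 2 : ℝ) ^ g ≤ 1 ∧ (1 / 2 : ℝ) ^ g < δ := by
  have h1 : |(1 / 2 : ℝ)| < 1 := by rw [abs_of_pos] <;> norm_num
  have h2 := tendsto_pow_const_mul_const_pow_of_abs_lt_one 1 h1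
  have h3 := tendsto_pow_const_mul_const_pow_of_abs_lt_one 0 h1
  have h4 := ((h3.const_mul (6 * D)).add (h2.const_mul (6 * D)))
  simp only [pow_zero, one_mul, pow_one, mul_zero, add_zero] at h3 h4
  obtain ⟨g, hg1, hg2⟩ := ((h4.eventually_lt_const one_pos).and
    (h3.eventually_lt_const hδ)).exists
  exact ⟨g, by linarith, hg2⟩

end PowerPath

theorem proposition2p3 (k : ℕ) (ε : ℝ) (hε : 0 < ε) :
    ∃ γ : ℝ, 0 < γ ∧ γ < ε / 4 ^ (k + 2) ∧ ∃ C : ℝ, 1 < C ∧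
      ∀ (G : (n : ℕ) → SimpleGraph (Fin n)) [∀ n, DecidableRel (G n).Adj] (p : ℕ → unitInterval),
        (∀ᶠ n : ℕ in Filter.atTop,
          ((k : ℝ) / ((k : ℝ) + 1) + ε) * (n : ℝ) ≤ ((G n).minDegree : ℝ)) →
        (∀ᶠ n : ℕ in Filter.atTop, C / (n : ℝ) ≤ (p n : ℝ)) →
        Filter.Tendsto
          (fun n : ℕ => SimpleGraph.binomialRandom (Fin n) (p n)
            {F : SimpleGraph (Fin n) | PowerPath.HasAbsorbingPaths k γ (G n ⊔ F)})
          Filter.atTop (nhds 1) := by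
  open PowerPath in
  classical
  -- Of the `2 * α * n` common neighbours, half may be lost to the set to be avoided. The cap at one
  -- gives `c₂ ≤ 1`.
  set α : ℝ := min ε 1 / 2 with hα
  have hα0 : 0 < α := by positivity
  have hαε : 2 * α ≤ ε := by rw [hα]; linarith [min_le_left ε 1]
  have hα1 : α ≤ 1 := by rw [hα]; linarith [min_le_right ε 1]
  obtain ⟨ι, _, _, π, M, q, hπ, hM, -, -, hι⟩ := connectable k
  obtain ⟨c₁, hc₁, hι⟩ := hι α hα0
  set c₂ : ℝ := α ^ (k + 1 + (k + 1)) / 2 with hc₂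
  have hc₂0 : 0 < c₂ := by positivity
  have hc₂1 : c₂ ≤ 1 := by
    have := pow_le_one₀ hα0.le hα1 (n := k + 1 + (k + 1))
    rw [hc₂]; linarith
  -- The exponent `2 * (k + 1)` counts the vertices of the two end cliques; the absorber families
  -- are indexed by two sets only.
  obtain ⟨C₁, hC₁⟩ := tendsto_exists_no_matching M hM hc₁ (2 * (k + 1))
  obtain ⟨C₂, hC₂⟩ := tendsto_exists_no_matching (halfMatching (k + 1))
    (isMatchingList_halfMatching _) hc₂0 0
  obtain ⟨g, hg1, hg2⟩ := exists_small_exponent (4 * (2 * (k + 1) + π.length) / c₂)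
    (min (ε / 4 ^ (k + 2)) (min α (1 / 2))) (by positivity)
  rw [lt_min_iff, lt_min_iff] at hg2
  refine ⟨(1 / 2 : ℝ) ^ g, by positivity, hg2.1, max (max C₁ C₂) 2,
    lt_of_lt_of_le one_lt_two (le_max_right _ _), ?_⟩
  intro G _ p hdeg hp
  have hp1 : ∀ᶠ n : ℕ in Filter.atTop, C₁ / (n : ℝ) ≤ p n := hp.mono fun n h =>
    le_trans (by gcongr; exact (le_max_left _ _).trans (le_max_left _ _)) h
  have hp2 : ∀ᶠ n : ℕ in Filter.atTop, C₂ / (n : ℝ) ≤ p n := hp.mono fun n h =>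
    le_trans (by gcongr; exact (le_max_right _ _).trans (le_max_left _ _)) h
  have hlim1 := hC₁ p (fun n => Finset (Fin n) × (Fin (k + 1) → Fin n) × (Fin (k + 1) → Fin n))
    (fun n => connectionFamily (G n) (k + 1) π M) hp1 (by
      intro n
      simp only [Fintype.card_prod, Fintype.card_finset, Fintype.card_fun, Fintype.card_fin]
      rw [two_mul (k + 1), pow_add n (k + 1) (k + 1)]
      gcongr
      norm_num)
  have hlim2 := hC₂ p (fun n => Finset (Fin n) × Finset (Fin n))
    (fun n => absorberFamily (G n) k c₂) hp2 (by
      intro n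
      simp only [Fintype.card_prod, Fintype.card_finset, Fintype.card_fin]
      rw [← mul_pow]
      norm_num)
  have hlim := ENNReal.Tendsto.sub (tendsto_const_nhds (x := (1 : ENNReal))) (hlim1.add hlim2)
    (Or.inl ENNReal.one_ne_top)
  rw [add_zero, tsub_zero] at hlim
  refine tendsto_of_tendsto_of_tendsto_of_le_of_le' hlim tendsto_const_nhds ?_
    (Filter.Eventually.of_forall fun n => MeasureTheory.prob_le_one)
  have hγ2 : (0 : ℝ) < ((1 / 2 : ℝ) ^ g) ^ 2 := by positivity
  filter_upwards [hdeg, tendsto_natCast_atTop_atTop.eventually_ge_atTop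
    (1 / ((1 / 2 : ℝ) ^ g) ^ 2)] with n hn hnγ
  rw [div_le_iff₀ hγ2] at hnγ
  have hcommon : HasCommonNbrs (G n) Set.univ Set.univ (k + 1)
      (2 * α * Fintype.card (Fin n)) := by
    refine (hasCommonNbrs_of_degree hε.le fun v => ?_).mono le_rfl (by gcongr)
    rw [Fintype.card_fin]
    refine hn.trans ?_
    rw [Nat.cast_le]
    refine ((G n).minDegree_le_degree v).trans (le_of_eq ?_)
    rw [Set.ncard_eq_toFinset_card', ← SimpleGraph.card_neighborFinset_eq_degree]
    congr 1
  rw [tsub_le_iff_right]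
  rw [← MeasureTheory.measure_univ (μ := SimpleGraph.binomialRandom (Fin n) (p n))]
  -- Every graph `F` lies in the desired event or in one of the two exceptional ones, and
  -- subadditivity requires no measurability.
  refine le_trans (MeasureTheory.measure_mono ?_) ((MeasureTheory.measure_union_le _ _).trans
    (add_le_add_right (MeasureTheory.measure_union_le _ _) _))
  intro F _
  by_cases h1 : ∀ i, c₁ * (n : ℝ) ^ Fintype.card ι ≤
      (connectionFamily (G n) (k + 1) π M i).ncard →
      ∃ f ∈ connectionFamily (G n) (k + 1) π M i, Function.Injective f ∧
        ∀ e ∈ M, F.Adj (f e.1) (f e.2)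
  · by_cases h2 : ∀ i, c₂ * (n : ℝ) ^ Fintype.card (Fin (k + 1 + (k + 1))) ≤
        (absorberFamily (G n) k c₂ i).ncard →
        ∃ f ∈ absorberFamily (G n) k c₂ i, Function.Injective f ∧
          ∀ e ∈ halfMatching (k + 1), F.Adj (f e.1) (f e.2)
    · left
      exact hasAbsorbingPaths_of_absorbers_of_connections hc₂0 hc₂1
        (hasAbsorbers_of_event hα0 hcommon (by simpa only [Fintype.card_fin] using h2))
        (hasConnections_of_event hπ (hι (Fin n)) hcommon
          (by simpa only [Fintype.card_fin] using h1))
        hg2.2.2.le hg2.2.1.le hg1 (by rw [Fintype.card_fin]; linarith)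
    · exact Or.inr (Or.inr h2)
  · exact Or.inr (Or.inl h1)
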